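/- **Setting.** Let $X\subset\mathbb R^n$ be a connected set and $U\subset\mathbb R^m$ a compact convex set. Consider two robots $i=1,2$ with states $x^i\in X$, inputs $u^i\in U$ and dynamics $\dot x^i=f^i(x^i)+g^i(x^i)u^i$, where $f^i,g^i$ are continuous on $X$. Robot $i$ occupies the polytope $\mathcal P^i(x^i)=\{z\in\mathbb R^l: A^i(x^i)z\le b^i(x^i)\}$ with $r^i$ inequalities, and we assume: * $A^i,b^i$ are continuously differentiable on a neighbourhood of every point of $X$; * there are $R,r>0$ such that for each $x^i\in X$ there is $c\in\mathbb R^l$ with $B_r(c)\subset\mathcal P^i(x^i)\subset B_R(c)$; * for each $x^i\in X$ no inequality of $A^i(x^i)z\le b^i(x^i)$ is redundant, and at every vertex of $\mathcal P^i(x^i)$ the active rows of $A^i(x^i)$ are linearly independent. Write $x=(x^1,x^2)\in X\times X$ and $u=(u^1,u^2)$. Let $h(x)=\min\{\|z^1-z^2\|^2: z^i\in\mathcal P^i(x^i)\}$. Let $(\lambda^{*1}(x),\lambda^{*2}(x))$ be the (unique) maximizer of $$L(\lambda^1,\lambda^2)=-\tfrac14\lambda^1A^1A^{1\,T}\lambda^{1\,T}-\lambda^1b^1-\lambda^2b^2$$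 over row vectors $\lambda^1,\lambda^2\ge0$ with $\lambda^1A^1+\lambda^2A^2=0$, where $A^i,b^i$ are taken at $x^i$. For $c\ge0$ let $\mathcal S_c$ be the closure in $X\times X$ of $\{x\in X\times X: h(x)>c\}$; the safe set is $\mathcal S=\mathcal S_0$. **The program.** Fix $\varepsilon_1,\varepsilon_2>0$, $M\in\mathbb R$ and a locally Lipschitz class-$\mathcal K$ function $\alpha:\mathbb R\to\mathbb R$ (continuous, strictly increasing, $\alpha(0)=0$). Put $\dot A^i=DA^i(x^i)[f^i(x^i)+g^i(x^i)u^i]$ and $\dot b^i=Db^i(x^i)[f^i(x^i)+g^i(x^i)u^i]$. The program at $x$ minimizes a cost $J(x;u,\dot\lambda^1,\dot\lambda^2)$ over $(u,\dot\lambda^1,\dot\lambda^2)$ subject to the following constraints, in which $\lambda^i=\lambda^{*i}(x)$: 1. $-\tfrac12\lambda^1A^1A^{1\,T}\dot\lambda^{1\,T}-\tfrac12\lambda^1A^1\dot A^{1\,T}\lambda^{1\,T}-\dot\lambda^1b^1-\lambda^1\dot b^1-\dot\lambda^2b^2-\lambda^2\dot b^2\ge-\alpha(h(x)-\varepsilon_1^2)$;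 2. $\dot\lambda^1A^1+\lambda^1\dot A^1+\lambda^2\dot A^2=-\dot\lambda^2A^2$; 3. $\dot\lambda^i_k\ge0$ whenever $\lambda^i_k<\varepsilon_2$; 4. $|\dot\lambda^i_k|\le M$ for all $i,k$; 5. $u^1,u^2\in U$. The cost $J$ is an arbitrary real-valued function; the usual choice is $J=\|u-u^{nom}(x)\|_Q^2$. **Closed loop.** For a set $S\subset X\times X$, a *feedback law of the program on $S$* is a measurable $u:X\times X\to U\times U$ such that, for every $x\in S$, $u(x)$ is the input part of a minimizer of the program at $x$. Let $F$ denote the closed-loop vector field $x\mapsto\big(f^i(x^i)+g^i(x^i)u^i(x)\big)_{i=1,2}$. A Filippov solution on $[0,T]$ is an absolutely continuous $x:[0,T]\to X\times X$ such that for almost every $t$ one has $$\dot x(t)\in\bigcap_{N\text{ null}}\mathrm{co}\big\{\lim_k F(x_{(k)}): x_{(k)}\to x(t),\ x_{(k)}\in (X\times X)\setminus N\big\}.$$ **Theorem.** For every cost $J$, the following hold. (i) Suppose that the program is feasible at every $x\in\mathcal S$ and that $u$ is a feedback law of the program on $\mathcal S$. Then every Filippov solution on $[0,T]$ with $x(0)\in\mathcal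 S$ satisfies $x(t)\in\mathcal S$ for all $t\in[0,T]$. (ii) Suppose only that the program is feasible at every $x\in\mathcal S_{\varepsilon_1^2}$ and that $u$ is a feedback law of the program on $\mathcal S_{\varepsilon_1^2}$. Then every Filippov solution on $[0,T]$ with $h(x(0))>\varepsilon_1^2$ satisfies $h(x(t))>\varepsilon_1^2$, and in particular $x(t)\in\mathcal S$, for all $t\in[0,T]$. -/

import Mathlib

open Set Filter Topology MeasureTheory

noncomputable section

namespace PolytopeNCBF

/-- The Filippov set-valued map of a vector field `F` that is defined on the domain `D`: the convex
hull of the limits of `F` along sequences of points of `D` that tend to `x` and avoid an arbitrary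
null set. Intersecting over all null sets `N` realizes "for a suitable null set `Q_F` and any
further null set `Q`". -/
def filippovMap {E : Type*} [NormedAddCommGroup E] [NormedSpace ℝ E] [MeasureSpace E]
    (D : Set E) (F : E → E) (x : E) : Set E :=
  ⋂ (N : Set E) (_ : volume N = 0),
    convexHull ℝ {v : E | ∃ y : ℕ → E, (∀ k, y k ∈ D \ N) ∧
      Tendsto y atTop (𝓝 x) ∧ Tendsto (fun k => F (y k)) atTop (𝓝 v)}

/-- `x` is a Filippov solution on `[0, T]` of `x' = F(x)` in `D`: an absolutely continuous map
`[0, T] → D` whose derivative lies in the Filippov map at almost every time. -/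
structure IsFilippovSolution {E : Type*} [NormedAddCommGroup E] [NormedSpace ℝ E] [MeasureSpace E]
    (D : Set E) (F : E → E) (T : ℝ) (x : ℝ → E) : Prop where
  nonneg : 0 ≤ T
  mem : ∀ t ∈ Icc 0 T, x t ∈ D
  absCont : AbsolutelyContinuousOnInterval x 0 T
  deriv_mem : ∀ᵐ t ∂(volume.restrict (Icc 0 T)), ∃ v ∈ filippovMap D F (x t), HasDerivAt x v t

/-- Class-K functions on the real line. -/
structure IsClassK (α : ℝ → ℝ) : Prop where
  continuous : Continuous α
  strictMono : StrictMono α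
  map_zero : α 0 = 0

/-- A robot with state in `ℝⁿ`, input in `ℝᵐ` and a body in `ℝˡ`: control-affine dynamics
`x' = f x + g x u` and the polytope `{z | A x z ≤ b x}` with `r` inequalities.
`A x k` is the `k`-th row of the matrix `A x`. -/
structure Robot (n m l r : ℕ) where
  f : EuclideanSpace ℝ (Fin n) → EuclideanSpace ℝ (Fin n)
  g : EuclideanSpace ℝ (Fin n) → EuclideanSpace ℝ (Fin m) →L[ℝ] EuclideanSpace ℝ (Fin n)
  A : EuclideanSpace ℝ (Fin n) → Fin r → EuclideanSpace ℝ (Fin l)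
  b : EuclideanSpace ℝ (Fin n) → Fin r → ℝ

/-- The product `lam * A` of a row vector with the matrix whose rows are `A k`. -/
def rowMul {l r : ℕ} (lam : Fin r → ℝ) (A : Fin r → EuclideanSpace ℝ (Fin l)) :
    EuclideanSpace ℝ (Fin l) :=
  ∑ k, lam k • A k

namespace Robot

variable {n m l r : ℕ} (P : Robot n m l r)

/-- The velocity `f x + g x u`. -/
def vel (x : EuclideanSpace ℝ (Fin n)) (u : EuclideanSpace ℝ (Fin m)) :
    EuclideanSpace ℝ (Fin n) :=
  P.f x + P.g x u

/-- The polytope occupied by the robot at state `x`. -/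
def body (x : EuclideanSpace ℝ (Fin n)) : Set (EuclideanSpace ℝ (Fin l)) :=
  {z | ∀ k, inner ℝ (P.A x k) z ≤ P.b x k}

/-- The Lie derivative `L_f A + L_g A u` of the rows of `A` at `x`. -/
def lieA (x : EuclideanSpace ℝ (Fin n)) (u : EuclideanSpace ℝ (Fin m)) :
    Fin r → EuclideanSpace ℝ (Fin l) :=
  fderiv ℝ P.A x (P.vel x u)

/-- The Lie derivative `L_f b + L_g b u` at `x`. -/
def lieB (x : EuclideanSpace ℝ (Fin n)) (u : EuclideanSpace ℝ (Fin m)) : Fin r → ℝ :=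
  fderiv ℝ P.b x (P.vel x u)

/-- The standing assumptions on a robot with state space `X`. The functions `A`, `b` are
continuously differentiable on a neighbourhood of every point of `X`. -/
structure Regular (X : Set (EuclideanSpace ℝ (Fin n))) : Prop where
  continuousOn_f : ContinuousOn P.f X
  continuousOn_g : ContinuousOn P.g X
  contDiffAt_A : ∀ x ∈ X, ContDiffAt ℝ 1 P.A x
  contDiffAt_b : ∀ x ∈ X, ContDiffAt ℝ 1 P.b x
  /-- The body contains a ball and lies in a concentric one, with radii uniform in the state. -/
  uniform_size : ∃ rad Rad : ℝ, 0 < rad ∧ 0 < Rad ∧ ∀ x ∈ X, ∃ c : EuclideanSpace ℝ (Fin l),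
    Metric.ball c rad ⊆ P.body x ∧ P.body x ⊆ Metric.ball c Rad
  /-- No inequality is implied by the others. -/
  irredundant : ∀ x ∈ X, ∀ k, ∃ z : EuclideanSpace ℝ (Fin l),
    (∀ j, j ≠ k → inner ℝ (P.A x j) z ≤ P.b x j) ∧ P.b x k < inner ℝ (P.A x k) z
  /-- The constraints active at a vertex are linearly independent. -/
  active_independent : ∀ x ∈ X, ∀ z ∈ (P.body x).extremePoints ℝ,
    LinearIndependent ℝ (fun k : {k : Fin r // inner ℝ (P.A x k) z = P.b x k} => P.A x k)

end Robot

section Pair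

variable {n m l r₁ r₂ : ℕ} (P₁ : Robot n m l r₁) (P₂ : Robot n m l r₂)

/-- The squared minimum distance between the two bodies at the joint state `x`. -/
def sqDist (x : EuclideanSpace ℝ (Fin n) × EuclideanSpace ℝ (Fin n)) : ℝ :=
  sInf ((fun z : EuclideanSpace ℝ (Fin l) × EuclideanSpace ℝ (Fin l) => ‖z.1 - z.2‖ ^ 2) ''
    (P₁.body x.1 ×ˢ P₂.body x.2))

/-- The closure, in `X × X`, of `{x | c < h x}`, where `h` is the squared minimum distance. The
safe set is the one with `c = 0`. -/
def superlevel (X : Set (EuclideanSpace ℝ (Fin n))) (c : ℝ) :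
    Set (EuclideanSpace ℝ (Fin n) × EuclideanSpace ℝ (Fin n)) :=
  (X ×ˢ X) ∩ closure {x | x ∈ X ×ˢ X ∧ c < sqDist P₁ P₂ x}

/-- The Lagrange dual function of the minimum distance problem. -/
def lagrangian (x : EuclideanSpace ℝ (Fin n) × EuclideanSpace ℝ (Fin n))
    (lam : (Fin r₁ → ℝ) × (Fin r₂ → ℝ)) : ℝ :=
  -(1 / 4) * inner ℝ (rowMul lam.1 (P₁.A x.1)) (rowMul lam.1 (P₁.A x.1))
    - lam.1 ⬝ᵥ P₁.b x.1 - lam.2 ⬝ᵥ P₂.b x.2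

/-- The feasible set of the dual of the minimum distance problem. -/
def dualFeasible (x : EuclideanSpace ℝ (Fin n) × EuclideanSpace ℝ (Fin n)) :
    Set ((Fin r₁ → ℝ) × (Fin r₂ → ℝ)) :=
  {lam | rowMul lam.1 (P₁.A x.1) + rowMul lam.2 (P₂.A x.2) = 0 ∧
    (∀ k, 0 ≤ lam.1 k) ∧ ∀ k, 0 ≤ lam.2 k}

/-- `lam` is an optimal solution of the dual of the minimum distance problem. -/
def IsDualOptimal (x : EuclideanSpace ℝ (Fin n) × EuclideanSpace ℝ (Fin n))
    (lam : (Fin r₁ → ℝ) × (Fin r₂ → ℝ)) : Prop :=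
  lam ∈ dualFeasible P₁ P₂ x ∧ IsMaxOn (lagrangian P₁ P₂ x) (dualFeasible P₁ P₂ x) lam

/-- The derivative of the Lagrange dual function along the dynamics with input `u`, where `dlam`
is the derivative of the dual variable `lam`. -/
def lagrangianDeriv (x : EuclideanSpace ℝ (Fin n) × EuclideanSpace ℝ (Fin n))
    (lam dlam : (Fin r₁ → ℝ) × (Fin r₂ → ℝ))
    (u : EuclideanSpace ℝ (Fin m) × EuclideanSpace ℝ (Fin m)) : ℝ :=
  -(1 / 2) * inner ℝ (rowMul lam.1 (P₁.A x.1)) (rowMul dlam.1 (P₁.A x.1))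
    - (1 / 2) * inner ℝ (rowMul lam.1 (P₁.A x.1)) (rowMul lam.1 (P₁.lieA x.1 u.1))
    - dlam.1 ⬝ᵥ P₁.b x.1 - lam.1 ⬝ᵥ P₁.lieB x.1 u.1
    - dlam.2 ⬝ᵥ P₂.b x.2 - lam.2 ⬝ᵥ P₂.lieB x.2 u.2

/-- The constraints of the quadratic program at `x` on the input `u` and the derivative `dlam` of
the dual variable, where `lam` is the dual optimal solution at `x`. -/
structure QPConstraints (U : Set (EuclideanSpace ℝ (Fin m))) (α : ℝ → ℝ) (ε₁ ε₂ M : ℝ)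
    (x : EuclideanSpace ℝ (Fin n) × EuclideanSpace ℝ (Fin n))
    (lam : (Fin r₁ → ℝ) × (Fin r₂ → ℝ))
    (u : EuclideanSpace ℝ (Fin m) × EuclideanSpace ℝ (Fin m))
    (dlam : (Fin r₁ → ℝ) × (Fin r₂ → ℝ)) : Prop where
  barrier : -α (sqDist P₁ P₂ x - ε₁ ^ 2) ≤ lagrangianDeriv P₁ P₂ x lam dlam u
  plane : rowMul dlam.1 (P₁.A x.1) + rowMul lam.1 (P₁.lieA x.1 u.1)
    + rowMul lam.2 (P₂.lieA x.2 u.2) = -rowMul dlam.2 (P₂.A x.2)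
  nonneg₁ : ∀ k, lam.1 k < ε₂ → 0 ≤ dlam.1 k
  nonneg₂ : ∀ k, lam.2 k < ε₂ → 0 ≤ dlam.2 k
  bound₁ : ∀ k, |dlam.1 k| ≤ M
  bound₂ : ∀ k, |dlam.2 k| ≤ M
  input₁ : u.1 ∈ U
  input₂ : u.2 ∈ U

/-- The feasible set of the quadratic program at `x`. (The dual optimal solution exists and is
unique for regular robots.) -/
def qpFeasible (U : Set (EuclideanSpace ℝ (Fin m))) (α : ℝ → ℝ) (ε₁ ε₂ M : ℝ)
    (x : EuclideanSpace ℝ (Fin n) × EuclideanSpace ℝ (Fin n)) :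
    Set ((EuclideanSpace ℝ (Fin m) × EuclideanSpace ℝ (Fin m)) ×
      ((Fin r₁ → ℝ) × (Fin r₂ → ℝ))) :=
  {p | ∃ lam, IsDualOptimal P₁ P₂ x lam ∧
    QPConstraints P₁ P₂ U α ε₁ ε₂ M x lam p.1 p.2}

/-- `u` is a measurable feedback law on `X × X` with values in `U × U` that, at every state `x` of
`S`, is the input part of a minimizer of the cost `J x` over the feasible set of the quadratic
program. -/
structure IsQPFeedback (X : Set (EuclideanSpace ℝ (Fin n))) (U : Set (EuclideanSpace ℝ (Fin m)))
    (α : ℝ → ℝ) (ε₁ ε₂ M : ℝ)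
    (J : EuclideanSpace ℝ (Fin n) × EuclideanSpace ℝ (Fin n) →
      (EuclideanSpace ℝ (Fin m) × EuclideanSpace ℝ (Fin m)) ×
        ((Fin r₁ → ℝ) × (Fin r₂ → ℝ)) → ℝ)
    (S : Set (EuclideanSpace ℝ (Fin n) × EuclideanSpace ℝ (Fin n)))
    (u : EuclideanSpace ℝ (Fin n) × EuclideanSpace ℝ (Fin n) →
      EuclideanSpace ℝ (Fin m) × EuclideanSpace ℝ (Fin m)) : Prop where
  aemeasurable : AEMeasurable u (volume.restrict (X ×ˢ X))
  mem_input : ∀ x ∈ X ×ˢ X, u x ∈ U ×ˢ U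
  isMin : ∀ x ∈ S, ∃ dlam, (u x, dlam) ∈ qpFeasible P₁ P₂ U α ε₁ ε₂ M x ∧
    IsMinOn (J x) (qpFeasible P₁ P₂ U α ε₁ ε₂ M x) (u x, dlam)

/-- The closed-loop vector field of the pair under the feedback law `u`. -/
def closedLoop (u : EuclideanSpace ℝ (Fin n) × EuclideanSpace ℝ (Fin n) →
      EuclideanSpace ℝ (Fin m) × EuclideanSpace ℝ (Fin m))
    (x : EuclideanSpace ℝ (Fin n) × EuclideanSpace ℝ (Fin n)) :
    EuclideanSpace ℝ (Fin n) × EuclideanSpace ℝ (Fin n) :=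
  (P₁.vel x.1 (u x).1, P₂.vel x.2 (u x).2)

end Pair

end PolytopeNCBF

end

/-! The two claims hold for different reasons. In (i), feasibility on the safe set already excludes
contact there. Where `h = 0` the dual optimum is `0`, so the program forces `dlam ≥ 0` and `dlam¹A¹
+ dlam²A² = 0`. Pairing with a common point of the bodies gives `dlam¹b¹ + dlam²b² ≥ 0`, whereas the
barrier constraint demands at most `α(-ε₁²) < 0` (`sqDist_pos_of_qpFeasible_nonempty`). Hence the
safe set is `{h > 0}`, open and closed in the connected `X × X`; being nonempty, it is everything
(`prod_subset_superlevel_zero`).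

In (ii), `h` obeys a differential inequality as long as `h > ε₁²`. By strong duality `h` is the dual
optimal value, and independence of the active rows makes the multipliers unique. They are also
locally bounded, so they pass to the limit and the constraints of the program have a closed graph.
For a fixed state these constraints are convex in `(u, dlam)`, so Filippov velocities are again
feasible (`filippovMap_subset_feasibleVelocities`).

For a feasible velocity, extrapolate `lam` linearly in time with slope `dlam`. Weak duality bounds
`h` from below by the Lagrangian up to an error of second rank, with equality at the current time.
Comparing derivatives gives `h' ≥ -α(h - ε₁²)` (`neg_le_of_hasDerivAt_sqDist`), without
differentiating the dual optimum. As `α` is Lipschitz near `0`, Grönwall's inequality keeps `h -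
ε₁²` from reaching `0` in finite time. -/

noncomputable section

namespace PolytopeNCBF

/-! ### Bilinear algebra of row vectors and matrices. -/

section RowMul

variable {l r : ℕ}

lemma rowMul_add_left (p q : Fin r → ℝ) (A : Fin r → EuclideanSpace ℝ (Fin l)) :
    rowMul (p + q) A = rowMul p A + rowMul q A := by
  simp [rowMul, add_smul, Finset.sum_add_distrib]

lemma rowMul_smul_left (a : ℝ) (p : Fin r → ℝ) (A : Fin r → EuclideanSpace ℝ (Fin l)) :
    rowMul (a • p) A = a • rowMul p A := by
  simp [rowMul, Finset.smul_sum, mul_smul]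

lemma rowMul_add_right (p : Fin r → ℝ) (A B : Fin r → EuclideanSpace ℝ (Fin l)) :
    rowMul p (A + B) = rowMul p A + rowMul p B := by
  simp [rowMul, Finset.sum_add_distrib]

lemma rowMul_smul_right (a : ℝ) (p : Fin r → ℝ) (A : Fin r → EuclideanSpace ℝ (Fin l)) :
    rowMul p (a • A) = a • rowMul p A := by
  simp only [rowMul, Finset.smul_sum, Pi.smul_apply]
  exact Finset.sum_congr rfl fun k _ => smul_comm _ _ _

@[simp] lemma rowMul_zero_left (A : Fin r → EuclideanSpace ℝ (Fin l)) :
    rowMul 0 A = 0 := by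
  simp [rowMul]

lemma inner_rowMul (p : Fin r → ℝ) (A : Fin r → EuclideanSpace ℝ (Fin l))
    (z : EuclideanSpace ℝ (Fin l)) :
    inner ℝ (rowMul p A) z = ∑ k, p k * inner ℝ (A k) z := by
  simp [rowMul, sum_inner, real_inner_smul_left]

end RowMul

/-! ### Linear programming over a compact polytope. -/

section Polytope

variable {l r : ℕ} {A : Fin r → EuclideanSpace ℝ (Fin l)} {b : Fin r → ℝ}

/-- The polytope `{z | A z ≤ b}`. -/
def polytope (A : Fin r → EuclideanSpace ℝ (Fin l)) (b : Fin r → ℝ) :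
    Set (EuclideanSpace ℝ (Fin l)) :=
  {z | ∀ k, inner ℝ (A k) z ≤ b k}

lemma isClosed_polytope : IsClosed (polytope A b) := by
  simp only [polytope, ofPred_forall]
  exact isClosed_iInter fun k => isClosed_le (by fun_prop) continuous_const

lemma convex_polytope : Convex ℝ (polytope A b) := by
  intro z hz w hw s t hs ht hst k
  rw [inner_add_right, real_inner_smul_right, real_inner_smul_right]
  calc s * inner ℝ (A k) z + t * inner ℝ (A k) w ≤ s * b k + t * b k :=
        add_le_add (mul_le_mul_of_nonneg_left (hz k) hs) (mul_le_mul_of_nonneg_left (hw k) ht)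
    _ = b k := by rw [← add_mul, hst, one_mul]

lemma inner_rowMul_le {lam : Fin r → ℝ} (hlam : ∀ k, 0 ≤ lam k) {z : EuclideanSpace ℝ (Fin l)}
    (hz : z ∈ polytope A b) : inner ℝ (rowMul lam A) z ≤ lam ⬝ᵥ b := by
  rw [inner_rowMul]
  exact Finset.sum_le_sum fun k _ => mul_le_mul_of_nonneg_left (hz k) (hlam k)

lemma inner_rowMul_add_le {lam : Fin r → ℝ} (hlam : ∀ k, 0 ≤ lam k)
    {c : EuclideanSpace ℝ (Fin l)} {δ : ℝ} (hc : ∀ k, inner ℝ (A k) c + δ ≤ b k) :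
    inner ℝ (rowMul lam A) c + δ * ∑ k, lam k ≤ lam ⬝ᵥ b := by
  rw [inner_rowMul, Finset.mul_sum, ← Finset.sum_add_distrib]
  refine Finset.sum_le_sum fun k _ => ?_
  have := mul_le_mul_of_nonneg_left (hc k) (hlam k)
  linarith

/-- A linear functional that attains its maximum over a compact polytope attains it at an extreme
point. -/
lemma exists_extremePoint_inner_eq (hcomp : IsCompact (polytope A b))
    {d z : EuclideanSpace ℝ (Fin l)} (hz : z ∈ polytope A b)
    (hmax : ∀ w ∈ polytope A b, inner ℝ d w ≤ inner ℝ d z) :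
    ∃ e ∈ (polytope A b).extremePoints ℝ, inner ℝ d e = inner ℝ d z := by
  -- The maximizers form a compact exposed face, and extreme points of a face are extreme in the
  -- polytope.
  set B : Set (EuclideanSpace ℝ (Fin l)) :=
    {x ∈ polytope A b | ∀ y ∈ polytope A b, innerSL ℝ d y ≤ innerSL ℝ d x} with hB
  have hexp : IsExposed ℝ (polytope A b) B := fun _ => ⟨innerSL ℝ d, rfl⟩
  have hzB : z ∈ B := ⟨hz, hmax⟩
  obtain ⟨e, he⟩ := (hexp.isCompact hcomp).extremePoints_nonempty ⟨z, hzB⟩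
  refine ⟨e, hexp.isExtreme.extremePoints_subset_extremePoints he, ?_⟩
  exact le_antisymm (hmax e he.1.1) (he.1.2 z hz)

lemma exists_inner_eq_of_linearIndependent {ι : Type*} {v : ι → EuclideanSpace ℝ (Fin l)}
    (hv : LinearIndependent ℝ v) (c : ι → ℝ) :
    ∃ w : EuclideanSpace ℝ (Fin l), ∀ i, inner ℝ (v i) w = c i := by
  -- Prescribe the functional on the basis `v` of its span, extend it, and represent it by a vector
  -- (Riesz).
  obtain ⟨g, hg⟩ := LinearMap.exists_extend ((Module.Basis.span hv).constr ℝ c)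
  refine ⟨(InnerProductSpace.toDual ℝ _).symm g.toContinuousLinearMap, fun i => ?_⟩
  rw [real_inner_comm, InnerProductSpace.toDual_symm_apply]
  have h := LinearMap.congr_fun hg (Module.Basis.span hv i)
  rw [Module.Basis.constr_basis] at h
  rw [← h]
  simp [Module.Basis.span_apply]

/-- If `e` maximizes `⟪d, ·⟫` over a polytope, then `d` is nonpositive on every direction that is
nonpositive on the rows active at `e`. -/
lemma inner_nonpos_of_active {d e w : EuclideanSpace ℝ (Fin l)} (he : e ∈ polytope A b)
    (hmax : ∀ z ∈ polytope A b, inner ℝ d z ≤ inner ℝ d e)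
    (hw : ∀ k, inner ℝ (A k) e = b k → inner ℝ (A k) w ≤ 0) : inner ℝ d w ≤ 0 := by
  have hev : ∀ᶠ t : ℝ in 𝓝[>] 0, e + t • w ∈ polytope A b := by
    refine eventually_all.2 fun k => ?_
    rcases (he k).eq_or_lt with h | h
    · filter_upwards [self_mem_nhdsWithin] with t ht
      rw [inner_add_right, real_inner_smul_right, h]
      have := mul_nonpos_of_nonneg_of_nonpos (le_of_lt (mem_Ioi.1 ht)) (hw k h)
      linarith
    · have hc : Continuous fun t : ℝ => inner ℝ (A k) (e + t • w) := by fun_prop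
      have : ∀ᶠ t : ℝ in 𝓝 0, inner ℝ (A k) (e + t • w) < b k :=
        hc.continuousAt.eventually_lt continuousAt_const (by simpa using h)
      exact (this.filter_mono nhdsWithin_le_nhds).mono fun t ht => ht.le
  obtain ⟨t, ht, ht0⟩ := (hev.and self_mem_nhdsWithin).exists
  have h := hmax _ ht
  rw [inner_add_right, real_inner_smul_right] at h
  have ht0 : 0 < t := ht0
  by_contra hcon
  have := mul_pos ht0 (not_le.1 hcon)
  linarith

/-- Existence of multipliers for the maximization of a linear functional over a compact polytope
with linearly independent active rows at the vertices. -/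
lemma exists_multiplier (hcomp : IsCompact (polytope A b))
    (hind : ∀ z ∈ (polytope A b).extremePoints ℝ,
      LinearIndependent ℝ (fun k : {k : Fin r // inner ℝ (A k) z = b k} => A k))
    {d z : EuclideanSpace ℝ (Fin l)} (hz : z ∈ polytope A b)
    (hmax : ∀ w ∈ polytope A b, inner ℝ d w ≤ inner ℝ d z) :
    ∃ lam : Fin r → ℝ, (∀ k, 0 ≤ lam k) ∧ rowMul lam A = d ∧ lam ⬝ᵥ b = inner ℝ d z := by
  classical
  obtain ⟨e, he, hez⟩ := exists_extremePoint_inner_eq hcomp hz hmax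
  have hmax' : ∀ w ∈ polytope A b, inner ℝ d w ≤ inner ℝ d e := fun w hw => hez ▸ hmax w hw
  have hli := hind e he
  set v := fun k : {k : Fin r // inner ℝ (A k) e = b k} => A k with hv
  -- If `w` is orthogonal to the active rows, both `w` and `-w` are admissible directions, so `d` is
  -- orthogonal to `w`.
  have hspan : d ∈ Submodule.span ℝ (range v) := by
    rw [← Submodule.orthogonal_orthogonal (Submodule.span ℝ (range v)),
      Submodule.mem_orthogonal]
    intro w hw
    have hw0 : ∀ k, inner ℝ (A k) e = b k → inner ℝ (A k) w = 0 := fun k hk =>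
      (Submodule.mem_orthogonal _ _).1 hw _ (Submodule.subset_span ⟨⟨k, hk⟩, rfl⟩)
    have h1 := inner_nonpos_of_active he.1 hmax' (w := w) fun k hk => (hw0 k hk).le
    have h2 := inner_nonpos_of_active he.1 hmax' (w := -w) fun k hk => by
      rw [inner_neg_right, hw0 k hk, neg_zero]
    rw [inner_neg_right] at h2
    rw [real_inner_comm]
    linarith
  obtain ⟨c, hc⟩ := (Submodule.mem_span_range_iff_exists_fun ℝ).1 hspan
  have hc0 : ∀ j, 0 ≤ c j := by
    intro j
    -- Independence provides a direction that leaves row `j` inward and keeps the other active rows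
    -- tight; testing `d` on it gives `-c j ≤ 0`.
    obtain ⟨w, hw⟩ := exists_inner_eq_of_linearIndependent hli
      (fun k => if k = j then (-1 : ℝ) else 0)
    have h1 := inner_nonpos_of_active he.1 hmax' (w := w) fun k hk => by
      have := hw ⟨k, hk⟩
      simp only [hv] at this
      rw [this]
      split_ifs <;> norm_num
    rw [← hc, sum_inner] at h1
    simp only [real_inner_smul_left, hw, mul_ite, mul_zero, Finset.sum_ite_eq',
      Finset.mem_univ, if_true] at h1
    linarith
  let lam : Fin r → ℝ := fun k => if h : inner ℝ (A k) e = b k then c ⟨k, h⟩ else 0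
  have hlam : rowMul lam A = d := by
    rw [← hc, rowMul]
    have h1 : ∑ k, lam k • A k = ∑ k with inner ℝ (A k) e = b k, lam k • A k := by
      rw [Finset.sum_filter]
      refine Finset.sum_congr rfl fun k _ => ?_
      split_ifs with h
      · rfl
      · simp [lam, h]
    rw [h1, ← Finset.sum_subtype_eq_sum_filter]
    simp only [Finset.subtype_univ]
    refine Finset.sum_congr rfl fun k _ => ?_
    simp [lam, hv, k.2]
  refine ⟨lam, fun k => ?_, hlam, ?_⟩
  · simp only [lam]
    split_ifs
    exacts [hc0 _, le_rfl]
  · rw [← hez, ← hlam, inner_rowMul]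
    refine Finset.sum_congr rfl fun k _ => ?_
    by_cases h : inner ℝ (A k) e = b k
    · rw [h]
    · simp [lam, h]

/-- Uniqueness of multipliers for the maximization of a linear functional over a compact polytope
with linearly independent active rows at the vertices. -/
lemma multiplier_unique (hcomp : IsCompact (polytope A b))
    (hind : ∀ z ∈ (polytope A b).extremePoints ℝ,
      LinearIndependent ℝ (fun k : {k : Fin r // inner ℝ (A k) z = b k} => A k))
    {d z : EuclideanSpace ℝ (Fin l)} (hz : z ∈ polytope A b) {p q : Fin r → ℝ}
    (hp : ∀ k, 0 ≤ p k) (hq : ∀ k, 0 ≤ q k) (hpd : rowMul p A = d) (hqd : rowMul q A = d)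
    (hpb : p ⬝ᵥ b = inner ℝ d z) (hqb : q ⬝ᵥ b = inner ℝ d z) : p = q := by
  classical
  have hmax : ∀ w ∈ polytope A b, inner ℝ d w ≤ inner ℝ d z := fun w hw => by
    rw [← hpb, ← hpd]
    exact inner_rowMul_le hp hw
  obtain ⟨e, he, hez⟩ := exists_extremePoint_inner_eq hcomp hz hmax
  -- Complementary slackness: the terms `s k * (b k - ⟪A k, e⟫)` are nonnegative with sum `0`. Both
  -- multipliers thus live on the independent rows active at `e`.
  have key : ∀ s : Fin r → ℝ, (∀ k, 0 ≤ s k) → rowMul s A = d → s ⬝ᵥ b = inner ℝ d z →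
      ∀ k, inner ℝ (A k) e ≠ b k → s k = 0 := by
    intro s hs hsd hsb k hk
    have h0 : ∑ k, s k * (b k - inner ℝ (A k) e) = 0 := by
      have : inner ℝ (rowMul s A) e = s ⬝ᵥ b := by rw [hsd, hsb, hez]
      rw [inner_rowMul] at this
      simp only [mul_sub, Finset.sum_sub_distrib]
      rw [this]
      simp [dotProduct]
    have h1 := (Finset.sum_eq_zero_iff_of_nonneg fun k _ =>
      mul_nonneg (hs k) (sub_nonneg.2 (he.1 k))).1 h0 k (Finset.mem_univ k)
    rcases mul_eq_zero.1 h1 with h | h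
    · exact h
    · exact absurd (sub_eq_zero.1 h).symm hk
  have hli := hind e he
  have hsum : ∑ k : {k : Fin r // inner ℝ (A k) e = b k}, (p k - q k) • A k = 0 := by
    have h1 : ∑ k, (p k - q k) • A k = 0 := by
      have : rowMul p A - rowMul q A = 0 := by rw [hpd, hqd, sub_self]
      simpa [rowMul, sub_smul, Finset.sum_sub_distrib] using this
    have h2 : ∑ k, (p k - q k) • A k
        = ∑ k with inner ℝ (A k) e = b k, (p k - q k) • A k := by
      rw [Finset.sum_filter]
      refine Finset.sum_congr rfl fun k _ => ?_
      split_ifs with h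
      · rfl
      · rw [key p hp hpd hpb k h, key q hq hqd hqb k h, sub_self, zero_smul]
    rw [h2, ← Finset.sum_subtype_eq_sum_filter] at h1
    simpa only [Finset.subtype_univ] using h1
  have h3 := Fintype.linearIndependent_iff.1 hli (fun k => p k - q k) hsum
  ext k
  by_cases h : inner ℝ (A k) e = b k
  · exact sub_eq_zero.1 (h3 ⟨k, h⟩)
  · rw [key p hp hpd hpb k h, key q hq hqd hqb k h]

end Polytope

/-! ### Dependence of one body on the state. -/

namespace Robot.Regular

variable {n m l r : ℕ} {P : Robot n m l r} {X : Set (EuclideanSpace ℝ (Fin n))}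
  {x : EuclideanSpace ℝ (Fin n)}

lemma isCompact_body (hP : P.Regular X) (hx : x ∈ X) : IsCompact (P.body x) := by
  obtain ⟨rad, Rad, -, -, h⟩ := hP.uniform_size
  obtain ⟨c, -, hc⟩ := h x hx
  exact Metric.isCompact_of_isClosed_isBounded (isClosed_polytope (A := P.A x) (b := P.b x))
    (Metric.isBounded_ball.subset hc)

lemma nonempty_body (hP : P.Regular X) (hx : x ∈ X) : (P.body x).Nonempty := by
  obtain ⟨rad, Rad, hrad, -, h⟩ := hP.uniform_size
  obtain ⟨c, hc, -⟩ := h x hx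
  exact ⟨c, hc (Metric.mem_ball_self hrad)⟩

/-- The body has a point at which all inequalities are strict. -/
lemma exists_strict (hP : P.Regular X) (hx : x ∈ X) :
    ∃ c, ∀ k, inner ℝ (P.A x k) c < P.b x k := by
  obtain ⟨rad, Rad, hrad, -, h⟩ := hP.uniform_size
  obtain ⟨c, hc, -⟩ := h x hx
  refine ⟨c, fun k => ?_⟩
  have hc0 : inner ℝ (P.A x k) c ≤ P.b x k := hc (Metric.mem_ball_self hrad) k
  -- For a zero row, irredundancy would force `b k < 0`, contradicting `c ∈ P.body x`.
  have hA : P.A x k ≠ 0 := fun h0 => by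
    obtain ⟨z, -, hz⟩ := hP.irredundant x hx k
    rw [h0, inner_zero_left] at hz hc0
    linarith
  have hn : 0 < ‖P.A x k‖ := norm_pos_iff.2 hA
  have hmem : c + (rad / 2 / ‖P.A x k‖) • P.A x k ∈ Metric.ball c rad := by
    rw [Metric.mem_ball, dist_eq_norm, add_sub_cancel_left, norm_smul, Real.norm_eq_abs,
      abs_of_pos (by positivity), div_mul_cancel₀ _ hn.ne']
    linarith
  have h1 := hc hmem k
  rw [inner_add_right, real_inner_smul_right, real_inner_self_eq_norm_sq] at h1
  have : 0 < rad / 2 / ‖P.A x k‖ * ‖P.A x k‖ ^ 2 := by positivity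
  linarith

lemma continuousAt_A (hP : P.Regular X) (hx : x ∈ X) : ContinuousAt P.A x :=
  (hP.contDiffAt_A x hx).continuousAt

lemma continuousAt_b (hP : P.Regular X) (hx : x ∈ X) : ContinuousAt P.b x :=
  (hP.contDiffAt_b x hx).continuousAt

/-- Near `x`, all inequalities have a uniform slack at a common point. -/
lemma exists_local_slack (hP : P.Regular X) (hx : x ∈ X) :
    ∃ c, ∃ δ : ℝ, 0 < δ ∧ ∀ᶠ x' in 𝓝 x, ∀ k, inner ℝ (P.A x' k) c + δ ≤ P.b x' k := by
  obtain ⟨c, hc⟩ := hP.exists_strict hx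
  have hδ : ∀ᶠ δ : ℝ in 𝓝[>] 0, ∀ k, inner ℝ (P.A x k) c + δ < P.b x k := by
    refine eventually_all.2 fun k => nhdsWithin_le_nhds ?_
    have hc' : Continuous fun δ : ℝ => inner ℝ (P.A x k) c + δ := by fun_prop
    exact hc'.continuousAt.eventually_lt continuousAt_const (by simpa using hc k)
  obtain ⟨δ, hδ, hδ0⟩ := (hδ.and self_mem_nhdsWithin).exists
  refine ⟨c, δ, hδ0, eventually_all.2 fun k => ?_⟩
  have hA : ContinuousAt (fun x' => P.A x' k) x := continuousAt_pi.1 (hP.continuousAt_A hx) k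
  have hb : ContinuousAt (fun x' => P.b x' k) x := continuousAt_pi.1 (hP.continuousAt_b hx) k
  exact (((hA.inner continuousAt_const).add continuousAt_const).eventually_lt hb (hδ k)).mono
    fun _ h => h.le

/-- The bodies are locally uniformly bounded. -/
lemma exists_local_bound (hP : P.Regular X) (hx : x ∈ X) :
    ∃ R : ℝ, 0 ≤ R ∧ ∀ᶠ x' in 𝓝[X] x, ∀ z ∈ P.body x', ‖z‖ ≤ R := by
  obtain ⟨rad, Rad, -, hRad, h⟩ := hP.uniform_size
  obtain ⟨c, δ, hδ, hc⟩ := hP.exists_local_slack hx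
  -- The enclosing ball may have a different centre at each state; the fixed point `c`, common to
  -- all nearby bodies, anchors these balls.
  refine ⟨‖c‖ + 2 * Rad, by positivity, ?_⟩
  filter_upwards [nhdsWithin_le_nhds hc, self_mem_nhdsWithin] with x' hcx hx' z hz
  obtain ⟨c', -, hc'⟩ := h x' hx'
  have hcm : c ∈ P.body x' := fun k => by linarith [hcx k]
  have h1 := Metric.mem_ball.1 (hc' hcm)
  have h2 := Metric.mem_ball.1 (hc' hz)
  have h3 := dist_triangle_right z c c'
  rw [dist_eq_norm] at h3
  have h4 := norm_le_insert' z c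
  linarith

/-- Moving a point of the body at `p` towards a suitable centre, by an amount proportional to the
distance of `p` and `q`, gives a point of the body at `q`. -/
lemma exists_local_shift (hP : P.Regular X) (hx : x ∈ X) :
    ∃ c, ∃ C : ℝ, 0 ≤ C ∧ ∃ s ∈ 𝓝[X] x, ∀ p ∈ s, ∀ q ∈ s, ∀ θ : ℝ, C * ‖p - q‖ ≤ θ → θ ≤ 1 →
      ∀ z ∈ P.body p, z + θ • (c - z) ∈ P.body q := by
  obtain ⟨c, δ, hδ, hc⟩ := hP.exists_local_slack hx
  obtain ⟨R, hR, hRb⟩ := hP.exists_local_bound hx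
  obtain ⟨KA, tA, htA, hA⟩ := (hP.contDiffAt_A x hx).exists_lipschitzOnWith
  obtain ⟨Kb, tb, htb, hb⟩ := (hP.contDiffAt_b x hx).exists_lipschitzOnWith
  -- Passing from `p` to `q` violates each inequality by at most `(KA * R + Kb) * ‖p - q‖`; the
  -- slack `δ` at `c` pays for it.
  refine ⟨c, (KA * R + Kb) / δ, by positivity, _,
    inter_mem (inter_mem (nhdsWithin_le_nhds hc) hRb)
      (inter_mem (nhdsWithin_le_nhds htA) (nhdsWithin_le_nhds htb)), ?_⟩
  rintro p ⟨⟨hcp, hRp⟩, hpA, hpb⟩ q ⟨⟨hcq, hRq⟩, hqA, hqb⟩ θ hθ hθ1 z hz k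
  have hθ0 : 0 ≤ θ := le_trans (by positivity) hθ
  rw [div_mul_eq_mul_div, div_le_iff₀ hδ] at hθ
  have h1 : ‖P.A q k - P.A p k‖ ≤ KA * ‖p - q‖ := by
    have h := hA.dist_le_mul q hqA p hpA
    rw [dist_eq_norm, dist_eq_norm, norm_sub_rev q p] at h
    exact (norm_le_pi_norm (P.A q - P.A p) k).trans h
  have h2 : |P.b q k - P.b p k| ≤ Kb * ‖p - q‖ := by
    have h := hb.dist_le_mul q hqb p hpb
    rw [dist_eq_norm, dist_eq_norm, norm_sub_rev q p] at h
    exact (norm_le_pi_norm (P.b q - P.b p) k).trans h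
  have h3 : inner ℝ (P.A q k) z ≤ P.b q k + (KA * R + Kb) * ‖p - q‖ := by
    have h4 : inner ℝ (P.A q k - P.A p k) z ≤ KA * ‖p - q‖ * R :=
      (real_inner_le_norm _ _).trans
        (mul_le_mul h1 (hRp z hz) (norm_nonneg _) (by positivity))
    rw [inner_sub_left] at h4
    have h5 := hz k
    have h6 := (abs_le.1 h2).1
    linarith
  have h7 := hcq k
  rw [inner_add_right, real_inner_smul_right, inner_sub_right]
  -- The bound is `(1 - θ)(b + θδ) + θ(b - δ) = b - θ²δ ≤ b`.
  have e1 := mul_le_mul_of_nonneg_left (h3.trans (add_le_add_right hθ _)) (sub_nonneg.2 hθ1)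
  have e2 := mul_le_mul_of_nonneg_left h7 hθ0
  have e3 : 0 ≤ θ * (θ * δ) := by positivity
  linarith

end Robot.Regular

/-! ### The minimum distance problem and its dual. -/

section Pair

variable {n m l r₁ r₂ : ℕ} {P₁ : Robot n m l r₁} {P₂ : Robot n m l r₂}
  {X : Set (EuclideanSpace ℝ (Fin n))} {x : EuclideanSpace ℝ (Fin n) × EuclideanSpace ℝ (Fin n)}
  {lam lam' : (Fin r₁ → ℝ) × (Fin r₂ → ℝ)}

lemma sqDist_le {z₁ z₂ : EuclideanSpace ℝ (Fin l)} (h₁ : z₁ ∈ P₁.body x.1)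
    (h₂ : z₂ ∈ P₂.body x.2) : sqDist P₁ P₂ x ≤ ‖z₁ - z₂‖ ^ 2 := by
  refine csInf_le ⟨0, ?_⟩ ⟨(z₁, z₂), ⟨h₁, h₂⟩, rfl⟩
  rintro _ ⟨z, -, rfl⟩
  positivity

lemma exists_sqDist_eq (hP₁ : P₁.Regular X) (hP₂ : P₂.Regular X) (hx : x ∈ X ×ˢ X) :
    ∃ z₁ ∈ P₁.body x.1, ∃ z₂ ∈ P₂.body x.2, sqDist P₁ P₂ x = ‖z₁ - z₂‖ ^ 2 := by
  have hc := (hP₁.isCompact_body hx.1).prod (hP₂.isCompact_body hx.2)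
  have hn := (hP₁.nonempty_body hx.1).prod (hP₂.nonempty_body hx.2)
  obtain ⟨z, hz, h⟩ := hc.exists_sInf_image_eq hn
    (f := fun z : EuclideanSpace ℝ (Fin l) × EuclideanSpace ℝ (Fin l) => ‖z.1 - z.2‖ ^ 2)
    (by fun_prop)
  exact ⟨z.1, hz.1, z.2, hz.2, h⟩

lemma sqDist_nonneg : 0 ≤ sqDist P₁ P₂ x := by
  refine Real.sInf_nonneg ?_
  rintro _ ⟨z, -, rfl⟩
  positivity

/-- The squared distance of the bodies is a locally Lipschitz function of the state. -/
lemma locallyLipschitzOn_sqDist (hP₁ : P₁.Regular X) (hP₂ : P₂.Regular X) :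
    LocallyLipschitzOn (X ×ˢ X) (sqDist P₁ P₂) := by
  intro x hx
  obtain ⟨c₁, C₁, hC₁, s₁, hs₁, h₁⟩ := hP₁.exists_local_shift hx.1
  obtain ⟨c₂, C₂, hC₂, s₂, hs₂, h₂⟩ := hP₂.exists_local_shift hx.2
  -- A single `θ = C * ‖q - p‖` has to shift both closest points at once, so that their difference
  -- moves to a convex combination with `c₁ - c₂`.
  set C := C₁ + C₂ with hC
  have hball : ∀ᶠ y in 𝓝[X ×ˢ X] x, C * ‖y - x‖ ≤ 1 / 2 := by
    have : ContinuousAt (fun y => C * ‖y - x‖) x := by fun_prop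
    refine nhdsWithin_le_nhds ((this.eventually_lt continuousAt_const ?_).mono fun _ h => h.le)
    simp
  refine ⟨Real.toNNReal (C * ‖c₁ - c₂‖ ^ 2),
    (s₁ ×ˢ s₂) ∩ {y | C * ‖y - x‖ ≤ 1 / 2} ∩ X ×ˢ X, ?_, ?_⟩
  · refine inter_mem (inter_mem ?_ hball) self_mem_nhdsWithin
    rw [← Prod.mk.eta (p := x), nhdsWithin_prod_eq]
    exact prod_mem_prod hs₁ hs₂
  · refine LipschitzOnWith.of_le_add_mul' _ ?_
    rintro p ⟨⟨⟨hp₁, hp₂⟩, hpb⟩, hpX⟩ q ⟨⟨⟨hq₁, hq₂⟩, hqb⟩, hqX⟩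
    obtain ⟨z₁, hz₁, z₂, hz₂, hz⟩ := exists_sqDist_eq hP₁ hP₂ hqX
    have hθ1 : C * ‖q - p‖ ≤ 1 := by
      have h3 := norm_sub_le_norm_sub_add_norm_sub q x p
      rw [norm_sub_rev x p] at h3
      have := mul_le_mul_of_nonneg_left h3 (by positivity : 0 ≤ C)
      simp only [mem_ofPred_eq] at hpb hqb
      linarith
    set θ := C * ‖q - p‖ with hθ
    have hθ0 : 0 ≤ θ := by positivity
    have w₁ := h₁ q.1 hq₁ p.1 hp₁ θ
      (mul_le_mul (by linarith) (norm_fst_le (q - p)) (norm_nonneg _) (by positivity)) hθ1 z₁ hz₁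
    have w₂ := h₂ q.2 hq₂ p.2 hp₂ θ
      (mul_le_mul (by linarith) (norm_snd_le (q - p)) (norm_nonneg _) (by positivity)) hθ1 z₂ hz₂
    have hle := sqDist_le (x := p) w₁ w₂
    have hconv : ‖z₁ + θ • (c₁ - z₁) - (z₂ + θ • (c₂ - z₂))‖ ^ 2
        ≤ (1 - θ) * ‖z₁ - z₂‖ ^ 2 + θ * ‖c₁ - c₂‖ ^ 2 := by
      have e : z₁ + θ • (c₁ - z₁) - (z₂ + θ • (c₂ - z₂))
          = (1 - θ) • (z₁ - z₂) + θ • (c₁ - c₂) := by module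
      rw [e]
      have hn : ‖(1 - θ) • (z₁ - z₂) + θ • (c₁ - c₂)‖
          ≤ (1 - θ) * ‖z₁ - z₂‖ + θ * ‖c₁ - c₂‖ := by
        refine (norm_add_le _ _).trans_eq ?_
        rw [norm_smul, norm_smul, Real.norm_of_nonneg hθ0,
          Real.norm_of_nonneg (sub_nonneg.2 hθ1)]
      refine (pow_le_pow_left₀ (norm_nonneg _) hn 2).trans ?_
      have : 0 ≤ θ * (1 - θ) * (‖z₁ - z₂‖ - ‖c₁ - c₂‖) ^ 2 :=
        mul_nonneg (mul_nonneg hθ0 (sub_nonneg.2 hθ1)) (sq_nonneg _)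
      linarith
    have hz0 : 0 ≤ θ * ‖z₁ - z₂‖ ^ 2 := by positivity
    rw [dist_comm, dist_eq_norm, hz]
    calc _ ≤ ‖z₁ - z₂‖ ^ 2 + θ * ‖c₁ - c₂‖ ^ 2 := by linarith
      _ = _ := by rw [hθ]; ring

/-- Weak duality for multipliers that satisfy the equality constraint of the dual problem only up
to a residual. -/
lemma lagrangian_le_of_mem (h₁ : ∀ k, 0 ≤ lam.1 k) (h₂ : ∀ k, 0 ≤ lam.2 k)
    {z₁ z₂ : EuclideanSpace ℝ (Fin l)} (hz₁ : z₁ ∈ P₁.body x.1) (hz₂ : z₂ ∈ P₂.body x.2) :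
    lagrangian P₁ P₂ x lam ≤ ‖z₁ - z₂‖ ^ 2
      - ‖z₁ - z₂ + (1 / 2 : ℝ) • rowMul lam.1 (P₁.A x.1)‖ ^ 2
      + ‖rowMul lam.1 (P₁.A x.1) + rowMul lam.2 (P₂.A x.2)‖ * ‖z₂‖ := by
  -- Bound each `lam b` below by its row combination at the point, replace the second combination by
  -- residual minus the first, and complete the square; the residual is paid by Cauchy–Schwarz.
  have e₁ := inner_rowMul_le h₁ hz₁
  have e₂ := inner_rowMul_le h₂ hz₂
  have e₃ := real_inner_le_norm (-(rowMul lam.1 (P₁.A x.1) + rowMul lam.2 (P₂.A x.2))) z₂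
  rw [norm_neg, inner_neg_left, inner_add_left] at e₃
  rw [norm_add_sq_real, norm_smul, real_inner_smul_right, real_inner_comm, inner_sub_right,
    Real.norm_of_nonneg (by norm_num : (0 : ℝ) ≤ 1 / 2), mul_pow, lagrangian,
    real_inner_self_eq_norm_sq]
  linarith

/-- The residual is allowed because the extrapolated multipliers of `neg_le_of_hasDerivAt_sqDist`
meet the equality constraint only to first order. -/
lemma lagrangian_le_sqDist_add (hP₁ : P₁.Regular X) (hP₂ : P₂.Regular X) (hx : x ∈ X ×ˢ X)
    (h₁ : ∀ k, 0 ≤ lam.1 k) (h₂ : ∀ k, 0 ≤ lam.2 k) {R : ℝ} (hR : ∀ z ∈ P₂.body x.2, ‖z‖ ≤ R) :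
    lagrangian P₁ P₂ x lam ≤ sqDist P₁ P₂ x
      + R * ‖rowMul lam.1 (P₁.A x.1) + rowMul lam.2 (P₂.A x.2)‖ := by
  obtain ⟨z₁, hz₁, z₂, hz₂, hz⟩ := exists_sqDist_eq hP₁ hP₂ hx
  have h := lagrangian_le_of_mem h₁ h₂ hz₁ hz₂
  have h3 := mul_le_mul_of_nonneg_right (hR z₂ hz₂)
    (norm_nonneg (rowMul lam.1 (P₁.A x.1) + rowMul lam.2 (P₂.A x.2)))
  have h4 := sq_nonneg ‖z₁ - z₂ + (1 / 2 : ℝ) • rowMul lam.1 (P₁.A x.1)‖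
  rw [hz]
  linarith

/-- Weak duality. -/
lemma lagrangian_le_sqDist (hP₁ : P₁.Regular X) (hP₂ : P₂.Regular X) (hx : x ∈ X ×ˢ X)
    (h : lam ∈ dualFeasible P₁ P₂ x) : lagrangian P₁ P₂ x lam ≤ sqDist P₁ P₂ x := by
  obtain ⟨R, -, hR⟩ := hP₂.exists_local_bound hx.2
  have := lagrangian_le_sqDist_add hP₁ hP₂ hx h.2.1 h.2.2 (hR.self_of_nhdsWithin hx.2)
  rwa [h.1, norm_zero, mul_zero, add_zero] at this

/-- Strong duality. -/
lemma exists_lagrangian_eq_sqDist (hP₁ : P₁.Regular X) (hP₂ : P₂.Regular X)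
    (hx : x ∈ X ×ˢ X) :
    ∃ lam ∈ dualFeasible P₁ P₂ x, lagrangian P₁ P₂ x lam = sqDist P₁ P₂ x := by
  obtain ⟨z₁, hz₁, z₂, hz₂, hz⟩ := exists_sqDist_eq hP₁ hP₂ hx
  have hvar : ∀ w₁ ∈ P₁.body x.1, ∀ w₂ ∈ P₂.body x.2,
      0 ≤ inner ℝ (z₁ - z₂) ((w₁ - z₁) - (w₂ - z₂)) := by
    intro w₁ hw₁ w₂ hw₂
    by_contra hneg
    set v := (w₁ - z₁) - (w₂ - z₂) with hv
    have hder : ∀ t : ℝ, 0 ≤ t → t ≤ 1 →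
        0 ≤ 2 * t * inner ℝ (z₁ - z₂) v + t ^ 2 * ‖v‖ ^ 2 := by
      intro t ht0 ht1
      have m₁ := convex_polytope.add_smul_sub_mem hz₁ hw₁ ⟨ht0, ht1⟩
      have m₂ := convex_polytope.add_smul_sub_mem hz₂ hw₂ ⟨ht0, ht1⟩
      have h := sqDist_le (x := x) m₁ m₂
      have e : z₁ + t • (w₁ - z₁) - (z₂ + t • (w₂ - z₂)) = (z₁ - z₂) + t • v := by
        rw [hv]; module
      rw [e, hz, norm_add_sq_real, norm_smul, real_inner_smul_right, mul_pow,
        Real.norm_of_nonneg ht0] at h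
      linarith
    set a := inner ℝ (z₁ - z₂) v with ha
    have ha0 : a < 0 := not_le.1 hneg
    -- With this `t ∈ (0, 1]` one gets `2a + t‖v‖² = a + ta < 0`, contradicting `hder`.
    have hpos : 0 < -a / (‖v‖ ^ 2 - a) := div_pos (by linarith) (by nlinarith [sq_nonneg ‖v‖])
    have hden : 0 < ‖v‖ ^ 2 - a := by nlinarith [sq_nonneg ‖v‖]
    have h1 := hder (-a / (‖v‖ ^ 2 - a)) hpos.le
      ((div_le_one hden).2 (by nlinarith [sq_nonneg ‖v‖]))
    set t := -a / (‖v‖ ^ 2 - a) with ht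
    have h2 : t * (‖v‖ ^ 2 - a) = -a := div_mul_cancel₀ _ hden.ne'
    have h3 : 0 ≤ 2 * a + t * ‖v‖ ^ 2 := by
      by_contra hcon
      have := mul_neg_of_pos_of_neg hpos (not_le.1 hcon)
      linarith
    have h4 : t * a < 0 := mul_neg_of_pos_of_neg hpos ha0
    linarith
  -- Fixing one closest point in `hvar` makes the other a maximizer of a linear functional. The two
  -- functionals are opposite, which is the dual equality constraint.
  obtain ⟨p, hp, hpd, hpb⟩ := exists_multiplier (hP₁.isCompact_body hx.1)
    (hP₁.active_independent _ hx.1) (d := (2 : ℝ) • (z₂ - z₁)) hz₁ fun w hw => by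
      have := hvar w hw z₂ hz₂
      rw [sub_self, sub_zero, inner_sub_right, inner_sub_left, inner_sub_left] at this
      rw [real_inner_smul_left, real_inner_smul_left, inner_sub_left, inner_sub_left]
      linarith
  obtain ⟨q, hq, hqd, hqb⟩ := exists_multiplier (hP₂.isCompact_body hx.2)
    (hP₂.active_independent _ hx.2) (d := (2 : ℝ) • (z₁ - z₂)) hz₂ fun w hw => by
      have := hvar z₁ hz₁ w hw
      rw [sub_self, zero_sub, inner_neg_right, inner_sub_right, inner_sub_left,
        inner_sub_left] at this
      rw [real_inner_smul_left, real_inner_smul_left, inner_sub_left, inner_sub_left]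
      linarith
  refine ⟨(p, q), ⟨?_, hp, hq⟩, ?_⟩
  · simp only [hpd, hqd]
    module
  · simp only [lagrangian, hpb, hqb, hpd, hz, ← real_inner_self_eq_norm_sq]
    simp only [real_inner_smul_left, real_inner_smul_right, inner_sub_left, inner_sub_right,
      real_inner_comm z₁ z₂]
    ring

lemma IsDualOptimal.lagrangian_eq (hP₁ : P₁.Regular X) (hP₂ : P₂.Regular X)
    (hx : x ∈ X ×ˢ X) (h : IsDualOptimal P₁ P₂ x lam) :
    lagrangian P₁ P₂ x lam = sqDist P₁ P₂ x := by
  obtain ⟨p, hp, hpe⟩ := exists_lagrangian_eq_sqDist hP₁ hP₂ hx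
  exact le_antisymm (lagrangian_le_sqDist hP₁ hP₂ hx h.1) (hpe ▸ h.2 hp)

lemma isDualOptimal_of_lagrangian_eq (hP₁ : P₁.Regular X) (hP₂ : P₂.Regular X)
    (hx : x ∈ X ×ˢ X) (h : lam ∈ dualFeasible P₁ P₂ x)
    (he : lagrangian P₁ P₂ x lam = sqDist P₁ P₂ x) : IsDualOptimal P₁ P₂ x lam :=
  ⟨h, fun _ hp => he ▸ lagrangian_le_sqDist hP₁ hP₂ hx hp⟩

/-- Optimality conditions at a pair of closest points. -/
lemma IsDualOptimal.complementary (hP₁ : P₁.Regular X) (hP₂ : P₂.Regular X)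
    (hx : x ∈ X ×ˢ X) (h : IsDualOptimal P₁ P₂ x lam) {z₁ z₂ : EuclideanSpace ℝ (Fin l)}
    (hz₁ : z₁ ∈ P₁.body x.1) (hz₂ : z₂ ∈ P₂.body x.2)
    (hz : sqDist P₁ P₂ x = ‖z₁ - z₂‖ ^ 2) :
    rowMul lam.1 (P₁.A x.1) = (2 : ℝ) • (z₂ - z₁) ∧
      rowMul lam.2 (P₂.A x.2) = (2 : ℝ) • (z₁ - z₂) ∧
      lam.1 ⬝ᵥ P₁.b x.1 = inner ℝ ((2 : ℝ) • (z₂ - z₁)) z₁ ∧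
      lam.2 ⬝ᵥ P₂.b x.2 = inner ℝ ((2 : ℝ) • (z₁ - z₂)) z₂ := by
  have hL := h.lagrangian_eq hP₁ hP₂ hx
  have hle := lagrangian_le_of_mem h.1.2.1 h.1.2.2 hz₁ hz₂
  rw [h.1.1, norm_zero, zero_mul, add_zero, hL, hz] at hle
  -- Equality in weak duality forces the completed square to vanish.
  have hd : z₁ - z₂ + (1 / 2 : ℝ) • rowMul lam.1 (P₁.A x.1) = 0 := by
    rw [← norm_eq_zero, ← sq_eq_zero_iff]
    exact le_antisymm (by linarith) (sq_nonneg _)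
  have hd₁ : rowMul lam.1 (P₁.A x.1) = (2 : ℝ) • (z₂ - z₁) := by
    have : (1 / 2 : ℝ) • rowMul lam.1 (P₁.A x.1) = z₂ - z₁ := by
      rw [← neg_sub z₁ z₂]
      exact eq_neg_of_add_eq_zero_right hd
    rw [← this, smul_smul]
    norm_num
  have hd₂ : rowMul lam.2 (P₂.A x.2) = (2 : ℝ) • (z₁ - z₂) := by
    rw [eq_neg_of_add_eq_zero_right h.1.1, hd₁]
    module
  have e₁ := inner_rowMul_le h.1.2.1 hz₁
  have e₂ := inner_rowMul_le h.1.2.2 hz₂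
  have e₃ : -(1 / 4) * inner ℝ ((2 : ℝ) • (z₂ - z₁)) ((2 : ℝ) • (z₂ - z₁))
      - inner ℝ ((2 : ℝ) • (z₂ - z₁)) z₁ - inner ℝ ((2 : ℝ) • (z₁ - z₂)) z₂
      = ‖z₁ - z₂‖ ^ 2 := by
    simp only [← real_inner_self_eq_norm_sq, real_inner_smul_left, real_inner_smul_right,
      inner_sub_left, inner_sub_right, real_inner_comm z₁ z₂]
    ring
  rw [lagrangian, hz] at hL
  rw [hd₁] at e₁ hL
  rw [hd₂] at e₂
  exact ⟨hd₁, hd₂, by linarith, by linarith⟩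

/-- The optimal solution of the dual problem is unique. -/
lemma IsDualOptimal.unique (hP₁ : P₁.Regular X) (hP₂ : P₂.Regular X) (hx : x ∈ X ×ˢ X)
    (h : IsDualOptimal P₁ P₂ x lam) (h' : IsDualOptimal P₁ P₂ x lam') : lam = lam' := by
  obtain ⟨z₁, hz₁, z₂, hz₂, hz⟩ := exists_sqDist_eq hP₁ hP₂ hx
  obtain ⟨a₁, a₂, a₃, a₄⟩ := h.complementary hP₁ hP₂ hx hz₁ hz₂ hz
  obtain ⟨b₁, b₂, b₃, b₄⟩ := h'.complementary hP₁ hP₂ hx hz₁ hz₂ hz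
  exact Prod.ext
    (multiplier_unique (hP₁.isCompact_body hx.1) (hP₁.active_independent _ hx.1) hz₁
      h.1.2.1 h'.1.2.1 a₁ b₁ a₃ b₃)
    (multiplier_unique (hP₂.isCompact_body hx.2) (hP₂.active_independent _ hx.2) hz₂
      h.1.2.2 h'.1.2.2 a₂ b₂ a₄ b₄)

lemma IsDualOptimal.lagrangian_nonneg (h : IsDualOptimal P₁ P₂ x lam) :
    0 ≤ lagrangian P₁ P₂ x lam := by
  have h0 : (0 : (Fin r₁ → ℝ) × (Fin r₂ → ℝ)) ∈ dualFeasible P₁ P₂ x := by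
    simp [dualFeasible]
  have := h.2 h0
  simpa [lagrangian] using this

/-- Optimal dual solutions are locally uniformly bounded. -/
lemma exists_local_bound_isDualOptimal (hP₁ : P₁.Regular X) (hP₂ : P₂.Regular X)
    (hx : x ∈ X ×ˢ X) :
    ∃ C : ℝ, ∀ᶠ y in 𝓝 x, ∀ lam, IsDualOptimal P₁ P₂ y lam →
      lam ∈ (Icc 0 (fun _ => C) : Set (Fin r₁ → ℝ)) ×ˢ (Icc 0 (fun _ => C) : Set (Fin r₂ → ℝ)) := by
  obtain ⟨c₁, δ₁, hδ₁, h₁⟩ := hP₁.exists_local_slack hx.1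
  obtain ⟨c₂, δ₂, hδ₂, h₂⟩ := hP₂.exists_local_slack hx.2
  set δ := min δ₁ δ₂ with hδ
  have hδ0 : 0 < δ := lt_min hδ₁ hδ₂
  -- Evaluated at `c₁`, `c₂` with slack `δ`, weak duality reads `0 ≤ L ≤ ‖c₁ - c₂‖² - δ ∑ lam`.
  refine ⟨‖c₁ - c₂‖ ^ 2 / δ, ?_⟩
  filter_upwards [continuousAt_fst.eventually h₁, continuousAt_snd.eventually h₂] with y hy₁ hy₂
    lam hlam
  have hL := hlam.lagrangian_nonneg
  have e₁ := inner_rowMul_add_le hlam.1.2.1 (δ := δ)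
    fun k => (add_le_add_right (min_le_left _ _) _).trans (hy₁ k)
  have e₂ := inner_rowMul_add_le hlam.1.2.2 (δ := δ)
    fun k => (add_le_add_right (min_le_right _ _) _).trans (hy₂ k)
  rw [eq_neg_of_add_eq_zero_right hlam.1.1, inner_neg_left] at e₂
  have e₃ := sq_nonneg ‖c₁ - c₂ + (1 / 2 : ℝ) • rowMul lam.1 (P₁.A y.1)‖
  rw [norm_add_sq_real, norm_smul, real_inner_smul_right, real_inner_comm, inner_sub_right,
    Real.norm_of_nonneg (by norm_num : (0 : ℝ) ≤ 1 / 2), mul_pow] at e₃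
  rw [lagrangian, real_inner_self_eq_norm_sq] at hL
  have hsum : δ * (∑ k, lam.1 k + ∑ k, lam.2 k) ≤ ‖c₁ - c₂‖ ^ 2 := by linarith
  have s₁ := Finset.sum_nonneg fun k (_ : k ∈ Finset.univ) => hlam.1.2.1 k
  have s₂ := Finset.sum_nonneg fun k (_ : k ∈ Finset.univ) => hlam.1.2.2 k
  have hdiv : ∑ k, lam.1 k + ∑ k, lam.2 k ≤ ‖c₁ - c₂‖ ^ 2 / δ := by
    rw [le_div_iff₀ hδ0, mul_comm]
    exact hsum
  refine ⟨⟨hlam.1.2.1, fun k => ?_⟩, ⟨hlam.1.2.2, fun k => ?_⟩⟩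
  · have := Finset.single_le_sum (fun k _ => hlam.1.2.1 k) (Finset.mem_univ k)
    dsimp only
    linarith
  · have := Finset.single_le_sum (fun k _ => hlam.1.2.2 k) (Finset.mem_univ k)
    dsimp only
    linarith

/-- A colliding state has the dual optimal solution `0`. -/
lemma IsDualOptimal.eq_zero (hP₁ : P₁.Regular X) (hP₂ : P₂.Regular X) (hx : x ∈ X ×ˢ X)
    (h : IsDualOptimal P₁ P₂ x lam) (h0 : sqDist P₁ P₂ x = 0) : lam = 0 :=
  h.unique hP₁ hP₂ hx <| isDualOptimal_of_lagrangian_eq hP₁ hP₂ hx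
    (by simp [dualFeasible]) (by simp [lagrangian, h0])

end Pair

/-! ### Closed graph and convexity of the program; Filippov velocities. -/

section Limits

variable {ι : Type*} {F : Filter ι} {l r : ℕ}

lemma tendsto_rowMul {p : ι → Fin r → ℝ} {A : ι → Fin r → EuclideanSpace ℝ (Fin l)}
    {p₀ : Fin r → ℝ} {A₀ : Fin r → EuclideanSpace ℝ (Fin l)} (hp : Tendsto p F (𝓝 p₀))
    (hA : Tendsto A F (𝓝 A₀)) : Tendsto (fun i => rowMul (p i) (A i)) F (𝓝 (rowMul p₀ A₀)) :=
  tendsto_finsetSum _ fun k _ =>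
    (tendsto_pi_nhds.1 hp k).smul (tendsto_pi_nhds.1 hA k)

lemma tendsto_dotProduct {p b : ι → Fin r → ℝ} {p₀ b₀ : Fin r → ℝ} (hp : Tendsto p F (𝓝 p₀))
    (hb : Tendsto b F (𝓝 b₀)) : Tendsto (fun i => p i ⬝ᵥ b i) F (𝓝 (p₀ ⬝ᵥ b₀)) :=
  ((continuous_fst.dotProduct continuous_snd).tendsto (p₀, b₀)).comp (hp.prodMk_nhds hb)

lemma tendsto_clm_apply {E G : Type*} [NormedAddCommGroup E] [NormedSpace ℝ E]
    [NormedAddCommGroup G] [NormedSpace ℝ G] {φ : ι → E →L[ℝ] G} {φ₀ : E →L[ℝ] G} {v : ι → E}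
    {v₀ : E} (hφ : Tendsto φ F (𝓝 φ₀)) (hv : Tendsto v F (𝓝 v₀)) :
    Tendsto (fun i => φ i (v i)) F (𝓝 (φ₀ v₀)) :=
  (isBoundedBilinearMap_apply.continuous.tendsto (φ₀, v₀)).comp (hφ.prodMk_nhds hv)

end Limits

namespace Robot

variable {n m l r : ℕ} {P : Robot n m l r} {X : Set (EuclideanSpace ℝ (Fin n))}
  {x : EuclideanSpace ℝ (Fin n)}

lemma vel_combo {a b : ℝ} (hab : a + b = 1) (u v : EuclideanSpace ℝ (Fin m)) :
    P.vel x (a • u + b • v) = a • P.vel x u + b • P.vel x v := by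
  simp only [vel, map_add, map_smul]
  calc _ = (a + b) • P.f x + (a • P.g x u + b • P.g x v) := by rw [hab, one_smul]
    _ = _ := by module

lemma lieA_combo {a b : ℝ} (hab : a + b = 1) (u v : EuclideanSpace ℝ (Fin m)) :
    P.lieA x (a • u + b • v) = a • P.lieA x u + b • P.lieA x v := by
  simp only [lieA, vel_combo hab, map_add, map_smul]

lemma lieB_combo {a b : ℝ} (hab : a + b = 1) (u v : EuclideanSpace ℝ (Fin m)) :
    P.lieB x (a • u + b • v) = a • P.lieB x u + b • P.lieB x v := by
  simp only [lieB, vel_combo hab, map_add, map_smul]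

variable {ι : Type*} {F : Filter ι} {y : ι → EuclideanSpace ℝ (Fin n)}
  {u : ι → EuclideanSpace ℝ (Fin m)} {u₀ : EuclideanSpace ℝ (Fin m)}

lemma Regular.tendsto_vel (hP : P.Regular X) (hx : x ∈ X) (hy : Tendsto y F (𝓝[X] x))
    (hu : Tendsto u F (𝓝 u₀)) : Tendsto (fun i => P.vel (y i) (u i)) F (𝓝 (P.vel x u₀)) :=
  ((hP.continuousOn_f x hx).tendsto.comp hy).add
    (tendsto_clm_apply ((hP.continuousOn_g x hx).tendsto.comp hy) hu)

lemma Regular.tendsto_lieA (hP : P.Regular X) (hx : x ∈ X) (hy : Tendsto y F (𝓝[X] x))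
    (hu : Tendsto u F (𝓝 u₀)) : Tendsto (fun i => P.lieA (y i) (u i)) F (𝓝 (P.lieA x u₀)) :=
  tendsto_clm_apply (((hP.contDiffAt_A x hx).continuousAt_fderiv one_ne_zero).tendsto.comp
    (tendsto_nhds_of_tendsto_nhdsWithin hy)) (hP.tendsto_vel hx hy hu)

lemma Regular.tendsto_lieB (hP : P.Regular X) (hx : x ∈ X) (hy : Tendsto y F (𝓝[X] x))
    (hu : Tendsto u F (𝓝 u₀)) : Tendsto (fun i => P.lieB (y i) (u i)) F (𝓝 (P.lieB x u₀)) :=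
  tendsto_clm_apply (((hP.contDiffAt_b x hx).continuousAt_fderiv one_ne_zero).tendsto.comp
    (tendsto_nhds_of_tendsto_nhdsWithin hy)) (hP.tendsto_vel hx hy hu)

end Robot

section Pair

variable {n m l r₁ r₂ : ℕ} {P₁ : Robot n m l r₁} {P₂ : Robot n m l r₂}
  {X : Set (EuclideanSpace ℝ (Fin n))} {U : Set (EuclideanSpace ℝ (Fin m))} {α : ℝ → ℝ}
  {ε₁ ε₂ M : ℝ} {x : EuclideanSpace ℝ (Fin n) × EuclideanSpace ℝ (Fin n)}
  {lam : (Fin r₁ → ℝ) × (Fin r₂ → ℝ)}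

/-- The closed-loop velocities at `x` of the inputs that are feasible for the quadratic program
with dual variable `lam`. -/
def feasibleVelocities (P₁ : Robot n m l r₁) (P₂ : Robot n m l r₂)
    (U : Set (EuclideanSpace ℝ (Fin m))) (α : ℝ → ℝ) (ε₁ ε₂ M : ℝ)
    (x : EuclideanSpace ℝ (Fin n) × EuclideanSpace ℝ (Fin n))
    (lam : (Fin r₁ → ℝ) × (Fin r₂ → ℝ)) :
    Set (EuclideanSpace ℝ (Fin n) × EuclideanSpace ℝ (Fin n)) :=
  {v | ∃ u dlam, QPConstraints P₁ P₂ U α ε₁ ε₂ M x lam u dlam ∧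
    v = (P₁.vel x.1 u.1, P₂.vel x.2 u.2)}

/-- No product of `u` and `dlam` occurs, so the expression is jointly affine; the drift `f` prevents
linearity, whence `a + b = 1`. -/
lemma lagrangianDeriv_combo {a b : ℝ} (hab : a + b = 1)
    (u v : EuclideanSpace ℝ (Fin m) × EuclideanSpace ℝ (Fin m))
    (p q : (Fin r₁ → ℝ) × (Fin r₂ → ℝ)) :
    lagrangianDeriv P₁ P₂ x lam (a • p + b • q) (a • u + b • v)
      = a * lagrangianDeriv P₁ P₂ x lam p u + b * lagrangianDeriv P₁ P₂ x lam q v := by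
  simp only [lagrangianDeriv, Prod.fst_add, Prod.snd_add, Prod.smul_fst, Prod.smul_snd,
    Robot.lieA_combo hab, Robot.lieB_combo hab, rowMul_add_left, rowMul_smul_left,
    rowMul_add_right, rowMul_smul_right, inner_add_right, real_inner_smul_right,
    add_dotProduct, dotProduct_add, smul_dotProduct, dotProduct_smul, smul_eq_mul]
  ring

/-- The indices in the sign constraint depend on `lam` alone, so every constraint is convex in `(u,
dlam)`. This absorbs the convex hull in the Filippov map. -/
lemma convex_feasibleVelocities (hU : Convex ℝ U) :
    Convex ℝ (feasibleVelocities P₁ P₂ U α ε₁ ε₂ M x lam) := by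
  have hbound : ∀ {a b p q : ℝ}, 0 ≤ a → 0 ≤ b → a + b = 1 → |p| ≤ M → |q| ≤ M →
      |a * p + b * q| ≤ M := by
    intro a b p q ha hb hab hp hq
    calc |a * p + b * q| ≤ |a * p| + |b * q| := abs_add_le _ _
      _ = a * |p| + b * |q| := by rw [abs_mul, abs_mul, abs_of_nonneg ha, abs_of_nonneg hb]
      _ ≤ a * M + b * M := by gcongr
      _ = M := by rw [← add_mul, hab, one_mul]
  rintro _ ⟨u, p, hp, rfl⟩ _ ⟨v, q, hq, rfl⟩ a b ha hb hab
  refine ⟨a • u + b • v, a • p + b • q, ⟨?_, ?_, ?_, ?_, ?_, ?_, ?_, ?_⟩, ?_⟩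
  · rw [lagrangianDeriv_combo hab]
    have h₁ := mul_le_mul_of_nonneg_left hp.barrier ha
    have h₂ := mul_le_mul_of_nonneg_left hq.barrier hb
    calc -α (sqDist P₁ P₂ x - ε₁ ^ 2) = a * -α (sqDist P₁ P₂ x - ε₁ ^ 2)
          + b * -α (sqDist P₁ P₂ x - ε₁ ^ 2) := by rw [← add_mul, hab, one_mul]
      _ ≤ _ := add_le_add h₁ h₂
  · have h₁ := congrArg (a • ·) hp.plane
    have h₂ := congrArg (b • ·) hq.plane
    have h := congrArg₂ (· + ·) h₁ h₂
    simp only [Prod.fst_add, Prod.snd_add, Prod.smul_fst, Prod.smul_snd, Robot.lieA_combo hab,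
      rowMul_add_left, rowMul_smul_left, rowMul_add_right, rowMul_smul_right] at h ⊢
    convert h using 1 <;> module
  · exact fun k hk => add_nonneg (mul_nonneg ha (hp.nonneg₁ k hk)) (mul_nonneg hb (hq.nonneg₁ k hk))
  · exact fun k hk => add_nonneg (mul_nonneg ha (hp.nonneg₂ k hk)) (mul_nonneg hb (hq.nonneg₂ k hk))
  · exact fun k => hbound ha hb hab (hp.bound₁ k) (hq.bound₁ k)
  · exact fun k => hbound ha hb hab (hp.bound₂ k) (hq.bound₂ k)
  · exact hU hp.input₁ hq.input₁ ha hb hab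
  · exact hU hp.input₂ hq.input₂ ha hb hab
  · simp [Robot.vel_combo hab]

/-- The constraints of the quadratic program have a closed graph; in particular limits of feasible
velocities are feasible. -/
lemma mem_feasibleVelocities_of_tendsto (hP₁ : P₁.Regular X) (hP₂ : P₂.Regular X)
    (hU : IsCompact U) (hα : Continuous α) (hx : x ∈ X ×ˢ X) (hlam : IsDualOptimal P₁ P₂ x lam)
    {y : ℕ → EuclideanSpace ℝ (Fin n) × EuclideanSpace ℝ (Fin n)}
    {u : ℕ → EuclideanSpace ℝ (Fin m) × EuclideanSpace ℝ (Fin m)}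
    {v : EuclideanSpace ℝ (Fin n) × EuclideanSpace ℝ (Fin n)}
    (hy : Tendsto y atTop (𝓝[X ×ˢ X] x))
    (hu : ∀ᶠ k in atTop, ∃ dlam, (u k, dlam) ∈ qpFeasible P₁ P₂ U α ε₁ ε₂ M (y k))
    (hv : Tendsto (fun k => (P₁.vel (y k).1 (u k).1, P₂.vel (y k).2 (u k).2)) atTop (𝓝 v)) :
    v ∈ feasibleVelocities P₁ P₂ U α ε₁ ε₂ M x lam := by
  obtain ⟨C, hC⟩ := exists_local_bound_isDualOptimal hP₁ hP₂ hx
  have hy' := tendsto_nhds_of_tendsto_nhdsWithin hy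
  obtain ⟨N, hN⟩ := eventually_atTop.1
    ((hu.and (hy'.eventually hC)).and (hy.eventually self_mem_nhdsWithin))
  choose dmul mul hopt hqp using fun k : ℕ => (hN (k + N) (Nat.le_add_left _ _)).1.1
  have hbox := fun k : ℕ => (hN (k + N) (Nat.le_add_left _ _)).1.2 _ (hopt k)
  have hyX := fun k : ℕ => (hN (k + N) (Nat.le_add_left _ _)).2
  have hcomp : IsCompact ((U ×ˢ U) ×ˢ
      (((Icc (fun _ => -M) (fun _ => M) : Set (Fin r₁ → ℝ)) ×ˢ
        (Icc (fun _ => -M) (fun _ => M) : Set (Fin r₂ → ℝ))) ×ˢ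
      ((Icc 0 (fun _ => C) : Set (Fin r₁ → ℝ)) ×ˢ (Icc 0 (fun _ => C) : Set (Fin r₂ → ℝ))))) :=
    (hU.prod hU).prod ((isCompact_Icc.prod isCompact_Icc).prod
      (isCompact_Icc.prod isCompact_Icc))
  obtain ⟨⟨u₀, d₀, m₀⟩, hmem, σ, hσ, hlim⟩ := hcomp.tendsto_subseq
    (x := fun k => (u (k + N), dmul k, mul k)) fun k =>
      ⟨⟨(hqp k).input₁, (hqp k).input₂⟩,
        ⟨⟨fun i => (abs_le.1 ((hqp k).bound₁ i)).1, fun i => (abs_le.1 ((hqp k).bound₁ i)).2⟩,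
          ⟨fun i => (abs_le.1 ((hqp k).bound₂ i)).1, fun i => (abs_le.1 ((hqp k).bound₂ i)).2⟩⟩,
        hbox k⟩
  have hshift : Tendsto (fun k => σ k + N) atTop atTop :=
    (tendsto_add_atTop_nat N).comp hσ.tendsto_atTop
  have tu : Tendsto (fun k => u (σ k + N)) atTop (𝓝 u₀) := hlim.fst_nhds
  have td : Tendsto (fun k => dmul (σ k)) atTop (𝓝 d₀) := hlim.snd_nhds.fst_nhds
  have tm : Tendsto (fun k => mul (σ k)) atTop (𝓝 m₀) := hlim.snd_nhds.snd_nhds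
  have ty : Tendsto (fun k => y (σ k + N)) atTop (𝓝[X ×ˢ X] x) := hy.comp hshift
  have ty' := tendsto_nhds_of_tendsto_nhdsWithin ty
  have ty₁ : Tendsto (fun k => (y (σ k + N)).1) atTop (𝓝[X] x.1) :=
    tendsto_nhdsWithin_iff.2 ⟨ty'.fst_nhds, .of_forall fun k => (hyX (σ k)).1⟩
  have ty₂ : Tendsto (fun k => (y (σ k + N)).2) atTop (𝓝[X] x.2) :=
    tendsto_nhdsWithin_iff.2 ⟨ty'.snd_nhds, .of_forall fun k => (hyX (σ k)).2⟩
  have tA₁ := (hP₁.continuousAt_A hx.1).tendsto.comp ty'.fst_nhds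
  have tA₂ := (hP₂.continuousAt_A hx.2).tendsto.comp ty'.snd_nhds
  have tb₁ := (hP₁.continuousAt_b hx.1).tendsto.comp ty'.fst_nhds
  have tb₂ := (hP₂.continuousAt_b hx.2).tendsto.comp ty'.snd_nhds
  have th : Tendsto (fun k => sqDist P₁ P₂ (y (σ k + N))) atTop (𝓝 (sqDist P₁ P₂ x)) :=
    ((locallyLipschitzOn_sqDist hP₁ hP₂).continuousOn x hx).tendsto.comp ty
  -- The limit multiplier is dual feasible with value `sqDist`, hence optimal, and the optimum is
  -- unique.
  have hm₀ : m₀ = lam := by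
    refine IsDualOptimal.unique hP₁ hP₂ hx (isDualOptimal_of_lagrangian_eq hP₁ hP₂ hx
      ⟨?_, hmem.2.2.1.1, hmem.2.2.2.1⟩ ?_) hlam
    · exact tendsto_nhds_unique
        ((tendsto_rowMul tm.fst_nhds tA₁).add (tendsto_rowMul tm.snd_nhds tA₂))
        (tendsto_const_nhds.congr fun k => ((hopt (σ k)).1.1).symm)
    · refine tendsto_nhds_unique (f := fun k => lagrangian P₁ P₂ (y (σ k + N)) (mul (σ k))) ?_
        (th.congr fun k => ((hopt (σ k)).lagrangian_eq hP₁ hP₂ (hyX (σ k))).symm)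
      have tr := tendsto_rowMul tm.fst_nhds tA₁
      exact (((tr.inner tr).const_mul _).sub (tendsto_dotProduct tm.fst_nhds tb₁)).sub
        (tendsto_dotProduct tm.snd_nhds tb₂)
  rw [hm₀] at tm
  have tv₁ := hP₁.tendsto_vel hx.1 ty₁ tu.fst_nhds
  have tv₂ := hP₂.tendsto_vel hx.2 ty₂ tu.snd_nhds
  have tlA₁ := hP₁.tendsto_lieA hx.1 ty₁ tu.fst_nhds
  have tlA₂ := hP₂.tendsto_lieA hx.2 ty₂ tu.snd_nhds
  have tlb₁ := hP₁.tendsto_lieB hx.1 ty₁ tu.fst_nhds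
  have tlb₂ := hP₂.tendsto_lieB hx.2 ty₂ tu.snd_nhds
  refine ⟨u₀, d₀, ⟨?_, ?_, ?_, ?_, ?_, ?_, hmem.1.1, hmem.1.2⟩, ?_⟩
  · refine le_of_tendsto_of_tendsto' ((hα.tendsto _).comp (th.sub_const _)).neg
      (g := fun k => lagrangianDeriv P₁ P₂ (y (σ k + N)) (mul (σ k)) (dmul (σ k)) (u (σ k + N)))
      ?_ fun k => (hqp (σ k)).barrier
    have tr := tendsto_rowMul tm.fst_nhds tA₁
    exact ((((((tr.inner (tendsto_rowMul td.fst_nhds tA₁)).const_mul _).sub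
      ((tr.inner (tendsto_rowMul tm.fst_nhds tlA₁)).const_mul _)).sub
      (tendsto_dotProduct td.fst_nhds tb₁)).sub (tendsto_dotProduct tm.fst_nhds tlb₁)).sub
      (tendsto_dotProduct td.snd_nhds tb₂)).sub (tendsto_dotProduct tm.snd_nhds tlb₂)
  · exact tendsto_nhds_unique
      (((tendsto_rowMul td.fst_nhds tA₁).add (tendsto_rowMul tm.fst_nhds tlA₁)).add
        (tendsto_rowMul tm.snd_nhds tlA₂))
      ((tendsto_rowMul td.snd_nhds tA₂).neg.congr fun k => (hqp (σ k)).plane.symm)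
  -- The condition `lam i < ε₂` is open, so it holds along the sequence and the sign constraint
  -- survives the limit.
  · intro i hi
    refine ge_of_tendsto (tendsto_pi_nhds.1 td.fst_nhds i) ?_
    filter_upwards [(tendsto_pi_nhds.1 tm.fst_nhds i).eventually_lt_const hi] with k hk
    exact (hqp (σ k)).nonneg₁ i hk
  · intro i hi
    refine ge_of_tendsto (tendsto_pi_nhds.1 td.snd_nhds i) ?_
    filter_upwards [(tendsto_pi_nhds.1 tm.snd_nhds i).eventually_lt_const hi] with k hk
    exact (hqp (σ k)).nonneg₂ i hk
  · exact fun i => abs_le.2 ⟨hmem.2.1.1.1 i, hmem.2.1.1.2 i⟩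
  · exact fun i => abs_le.2 ⟨hmem.2.1.2.1 i, hmem.2.1.2.2 i⟩
  · exact tendsto_nhds_unique (hv.comp hshift) (tv₁.prodMk_nhds tv₂)

/-- Near a state around which the feedback is feasible, the Filippov map of the closed loop
consists of feasible velocities. -/
lemma filippovMap_subset_feasibleVelocities (hP₁ : P₁.Regular X) (hP₂ : P₂.Regular X)
    (hUc : Convex ℝ U) (hU : IsCompact U) (hα : Continuous α) (hx : x ∈ X ×ˢ X)
    (hlam : IsDualOptimal P₁ P₂ x lam)
    {u : EuclideanSpace ℝ (Fin n) × EuclideanSpace ℝ (Fin n) →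
      EuclideanSpace ℝ (Fin m) × EuclideanSpace ℝ (Fin m)}
    (hu : ∀ᶠ y in 𝓝[X ×ˢ X] x, ∃ dlam, (u y, dlam) ∈ qpFeasible P₁ P₂ U α ε₁ ε₂ M y) :
    filippovMap (X ×ˢ X) (closedLoop P₁ P₂ u) x
      ⊆ feasibleVelocities P₁ P₂ U α ε₁ ε₂ M x lam := by
  -- The null set `∅` is enough: feasibility holds at every nearby state of `X × X`, so none has to
  -- be discarded.
  refine (iInter₂_subset (∅ : Set (EuclideanSpace ℝ (Fin n) × EuclideanSpace ℝ (Fin n)))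
    measure_empty).trans (convexHull_min ?_ (convex_feasibleVelocities hUc))
  rintro v ⟨y, hyD, hyx, hyv⟩
  have hy : Tendsto y atTop (𝓝[X ×ˢ X] x) :=
    tendsto_nhdsWithin_iff.2 ⟨hyx, .of_forall fun k => (hyD k).1⟩
  exact mem_feasibleVelocities_of_tendsto hP₁ hP₂ hU hα hx hlam (u := fun k => u (y k)) hy
    (hy.eventually hu) hyv

end Pair

/-! ### Derivative comparison and Grönwall's inequality. -/

section Calculus

/-- Only the right side of `t` is used, because the sign constraint on `dlam` keeps the extrapolated
multipliers nonnegative only forward in time. -/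
lemma nonneg_of_hasDerivAt_of_eventually_nonneg {ψ : ℝ → ℝ} {ψ' t : ℝ} (h : HasDerivAt ψ ψ' t)
    (h0 : ψ t = 0) (hev : ∀ᶠ s in 𝓝[>] t, 0 ≤ ψ s) : 0 ≤ ψ' := by
  have hs := (hasDerivWithinAt_iff_tendsto_slope' (by simp)).1 (h.hasDerivWithinAt (s := Ioi t))
  refine ge_of_tendsto hs ?_
  filter_upwards [hev, self_mem_nhdsWithin] with s hs hst
  rw [slope_def_field, h0, sub_zero]
  exact div_nonneg hs (sub_nonneg.2 (le_of_lt hst))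

/-- The norm is not smooth at `0`, but here `ρ s = o(s - t)`. This makes the residual in weak
duality negligible to first order. -/
lemma hasDerivAt_norm_zero {E : Type*} [NormedAddCommGroup E] [NormedSpace ℝ E] {ρ : ℝ → E}
    {t : ℝ} (h : HasDerivAt ρ 0 t) (h0 : ρ t = 0) : HasDerivAt (fun s => ‖ρ s‖) 0 t := by
  rw [hasDerivAt_iff_isLittleO] at h ⊢
  simp only [h0, norm_zero, smul_zero, sub_zero] at h ⊢
  exact h.norm_left

variable {l r : ℕ} {t : ℝ}

lemma hasDerivAt_rowMul {p : ℝ → Fin r → ℝ} {A : ℝ → Fin r → EuclideanSpace ℝ (Fin l)}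
    {p' : Fin r → ℝ} {A' : Fin r → EuclideanSpace ℝ (Fin l)} (hp : HasDerivAt p p' t)
    (hA : HasDerivAt A A' t) :
    HasDerivAt (fun s => rowMul (p s) (A s)) (rowMul p' (A t) + rowMul (p t) A') t := by
  have h := HasDerivAt.fun_sum (u := Finset.univ) fun k _ =>
    (hasDerivAt_pi.1 hp k).smul (hasDerivAt_pi.1 hA k)
  rw [Finset.sum_add_distrib, add_comm] at h
  exact h

lemma hasDerivAt_dotProduct {p b : ℝ → Fin r → ℝ} {p' b' : Fin r → ℝ} (hp : HasDerivAt p p' t)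
    (hb : HasDerivAt b b' t) :
    HasDerivAt (fun s => p s ⬝ᵥ b s) (p' ⬝ᵥ b t + p t ⬝ᵥ b') t := by
  have h := HasDerivAt.fun_sum (u := Finset.univ) fun k _ =>
    (hasDerivAt_pi.1 hp k).mul (hasDerivAt_pi.1 hb k)
  rw [Finset.sum_add_distrib] at h
  exact h

/-- A locally Lipschitz image of an absolutely continuous curve is absolutely continuous. -/
lemma absolutelyContinuousOnInterval_comp {E G : Type*} [PseudoMetricSpace E]
    [PseudoMetricSpace G] {φ : E → G} {s : Set E} {K : NNReal} (hφ : LipschitzOnWith K φ s)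
    {x : ℝ → E} {a b : ℝ} (hx : AbsolutelyContinuousOnInterval x a b)
    (hmaps : MapsTo x (uIcc a b) s) : AbsolutelyContinuousOnInterval (fun t => φ (x t)) a b := by
  rw [absolutelyContinuousOnInterval_iff] at hx ⊢
  intro ε hε
  obtain ⟨δ, hδ, h⟩ := hx (ε / (K + 1)) (by positivity)
  refine ⟨δ, hδ, fun I hI hlt => ?_⟩
  have h1 := h I hI hlt
  rw [lt_div_iff₀ (by positivity)] at h1
  refine lt_of_le_of_lt ?_ h1
  rw [Finset.sum_mul]
  refine Finset.sum_le_sum fun i hi => ?_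
  have h2 := hφ.dist_le_mul _ (hmaps (hI.1 i hi).1) _ (hmaps (hI.1 i hi).2)
  have h3 : 0 ≤ dist (x (I.2 i).1) (x (I.2 i).2) := dist_nonneg
  linarith

/-- Grönwall's inequality from below for absolutely continuous functions. -/
lemma exp_mul_le_of_ae_deriv_ge {φ : ℝ → ℝ} {a b K : ℝ} (hab : a ≤ b)
    (hφ : AbsolutelyContinuousOnInterval φ a b)
    (h : ∀ᵐ s, s ∈ Ioo a b → ∀ η, HasDerivAt φ η s → -(K * φ s) ≤ η) :
    Real.exp (K * a) * φ a ≤ Real.exp (K * b) * φ b := by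
  -- The product `exp (K s) * φ s` is absolutely continuous with nonnegative derivative almost
  -- everywhere, and it is the integral of that derivative.
  have hexp : AbsolutelyContinuousOnInterval (fun s => Real.exp (K * s)) a b :=
    ContDiffOn.absolutelyContinuousOnInterval (by fun_prop)
  have hac := hexp.fun_mul hφ
  rw [← sub_nonneg, ← hac.integral_deriv_eq_sub]
  refine intervalIntegral.integral_nonneg_of_ae_restrict hab ?_
  rw [← Measure.restrict_congr_set Ioo_ae_eq_Icc]
  refine (ae_restrict_iff' measurableSet_Ioo).2 ?_
  filter_upwards [h, hφ.ae_differentiableAt] with s hs hd hmem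
  have hds := (hd (by rw [uIcc_of_le hab]; exact Ioo_subset_Icc_self hmem)).hasDerivAt
  have h1 := hs hmem _ hds
  have h2 : HasDerivAt (fun s => Real.exp (K * s)) (Real.exp (K * s) * K) s := by
    simpa using ((hasDerivAt_id s).const_mul K).exp
  rw [Pi.zero_apply, (h2.fun_mul hds).deriv]
  have h3 := mul_le_mul_of_nonneg_left h1 (Real.exp_pos (K * s)).le
  linarith

end Calculus

/-! ### The barrier inequality and invariance. -/

section Pair

variable {n m l r₁ r₂ : ℕ} {P₁ : Robot n m l r₁} {P₂ : Robot n m l r₂}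
  {X : Set (EuclideanSpace ℝ (Fin n))} {U : Set (EuclideanSpace ℝ (Fin m))} {α : ℝ → ℝ}
  {ε₁ ε₂ M : ℝ}

/-- Along a curve whose velocity is feasible for the quadratic program, the derivative of the
squared distance is bounded below by the barrier constraint. -/
lemma neg_le_of_hasDerivAt_sqDist (hP₁ : P₁.Regular X) (hP₂ : P₂.Regular X) (hε₂ : 0 < ε₂)
    {x : ℝ → EuclideanSpace ℝ (Fin n) × EuclideanSpace ℝ (Fin n)} {t η : ℝ}
    {v : EuclideanSpace ℝ (Fin n) × EuclideanSpace ℝ (Fin n)}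
    {lam : (Fin r₁ → ℝ) × (Fin r₂ → ℝ)}
    (ht : x t ∈ X ×ˢ X) (hmem : ∀ᶠ s in 𝓝[>] t, x s ∈ X ×ˢ X)
    (hlam : IsDualOptimal P₁ P₂ (x t) lam) (hx : HasDerivAt x v t)
    (hv : v ∈ feasibleVelocities P₁ P₂ U α ε₁ ε₂ M (x t) lam)
    (hη : HasDerivAt (fun s => sqDist P₁ P₂ (x s)) η t) :
    -α (sqDist P₁ P₂ (x t) - ε₁ ^ 2) ≤ η := by
  obtain ⟨u, d, hqp, rfl⟩ := hv
  refine hqp.barrier.trans ?_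
  obtain ⟨R, -, hR⟩ := hP₂.exists_local_bound ht.2
  have hx₁ : HasDerivAt (fun s => (x s).1) (P₁.vel (x t).1 u.1) t := hx.fst
  have hx₂ : HasDerivAt (fun s => (x s).2) (P₂.vel (x t).2 u.2) t := hx.snd
  have hA₁ : HasDerivAt (fun s => P₁.A (x s).1) (P₁.lieA (x t).1 u.1) t :=
    ((hP₁.contDiffAt_A _ ht.1).differentiableAt one_ne_zero).hasFDerivAt.comp_hasDerivAt t hx₁
  have hA₂ : HasDerivAt (fun s => P₂.A (x s).2) (P₂.lieA (x t).2 u.2) t :=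
    ((hP₂.contDiffAt_A _ ht.2).differentiableAt one_ne_zero).hasFDerivAt.comp_hasDerivAt t hx₂
  have hb₁ : HasDerivAt (fun s => P₁.b (x s).1) (P₁.lieB (x t).1 u.1) t :=
    ((hP₁.contDiffAt_b _ ht.1).differentiableAt one_ne_zero).hasFDerivAt.comp_hasDerivAt t hx₁
  have hb₂ : HasDerivAt (fun s => P₂.b (x s).2) (P₂.lieB (x t).2 u.2) t :=
    ((hP₂.contDiffAt_b _ ht.2).differentiableAt one_ne_zero).hasFDerivAt.comp_hasDerivAt t hx₂
  have hline : ∀ {r : ℕ} (p q : Fin r → ℝ), HasDerivAt (fun s : ℝ => p + (s - t) • q) q t := by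
    intro r p q
    simpa using (((hasDerivAt_id t).sub_const t).smul_const q).const_add p
  -- These multipliers need not be optimal at later times; weak duality asks only for nonnegativity
  -- and a small residual.
  set p₁ : ℝ → Fin r₁ → ℝ := fun s => lam.1 + (s - t) • d.1 with hp₁
  set p₂ : ℝ → Fin r₂ → ℝ := fun s => lam.2 + (s - t) • d.2 with hp₂
  have hp₁t : p₁ t = lam.1 := by simp [hp₁]
  have hp₂t : p₂ t = lam.2 := by simp [hp₂]
  have hd₁ : HasDerivAt p₁ d.1 t := hline _ _
  have hd₂ : HasDerivAt p₂ d.2 t := hline _ _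
  have hr₁ := hasDerivAt_rowMul hd₁ hA₁
  have hr₂ := hasDerivAt_rowMul hd₂ hA₂
  have hs₁ := hasDerivAt_dotProduct hd₁ hb₁
  have hs₂ := hasDerivAt_dotProduct hd₂ hb₂
  have hL := (((hr₁.inner ℝ hr₁).const_mul (-(1 / 4))).sub hs₁).sub hs₂
  have hρ := hr₁.fun_add hr₂
  simp only [hp₁t, hp₂t] at hL hρ
  have hρ0 : rowMul d.1 (P₁.A (x t).1) + rowMul lam.1 (P₁.lieA (x t).1 u.1)
      + (rowMul d.2 (P₂.A (x t).2) + rowMul lam.2 (P₂.lieA (x t).2 u.2)) = 0 := by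
    have := eq_neg_iff_add_eq_zero.1 hqp.plane
    rw [← this]
    abel
  rw [hρ0] at hρ
  have hnorm := hasDerivAt_norm_zero hρ (by rw [hp₁t, hp₂t]; exact hlam.1.1)
  -- The compared function is `h + R * ‖residual‖ - L`: it vanishes at `t` and is nonnegative just
  -- after `t`.
  have hψ := (hη.fun_add (hnorm.const_mul R)).fun_sub hL
  -- Components below `ε₂` have nonnegative slope; the others start at least at `ε₂ > 0` and stay
  -- positive for a short time.
  have hnonneg : ∀ {r : ℕ} {p q : Fin r → ℝ}, (∀ k, 0 ≤ p k) → (∀ k, p k < ε₂ → 0 ≤ q k) →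
      ∀ᶠ s in 𝓝[>] t, ∀ k, 0 ≤ (p + (s - t) • q) k := by
    intro r p q hp hq
    refine eventually_all.2 fun k => ?_
    by_cases hk : p k < ε₂
    · filter_upwards [self_mem_nhdsWithin] with s hs
      exact add_nonneg (hp k) (mul_nonneg (sub_nonneg.2 (le_of_lt hs)) (hq k hk))
    · have hc : Continuous fun s : ℝ => (p + (s - t) • q) k := by fun_prop
      have : ∀ᶠ s : ℝ in 𝓝 t, 0 < (p + (s - t) • q) k :=
        continuousAt_const.eventually_lt hc.continuousAt (by simpa using hε₂.trans_le (not_lt.1 hk))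
      exact nhdsWithin_le_nhds (this.mono fun _ h => h.le)
  have htend : Tendsto (fun s => (x s).2) (𝓝[>] t) (𝓝[X] (x t).2) :=
    tendsto_nhdsWithin_iff.2 ⟨hx₂.continuousAt.tendsto.mono_left nhdsWithin_le_nhds,
      hmem.mono fun s hs => hs.2⟩
  have hfin := nonneg_of_hasDerivAt_of_eventually_nonneg hψ ?_ ?_
  · have hcomm := real_inner_comm (rowMul d.1 (P₁.A (x t).1) + rowMul lam.1 (P₁.lieA (x t).1 u.1))
      (rowMul lam.1 (P₁.A (x t).1))
    rw [hcomm, inner_add_left, real_inner_comm,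
      real_inner_comm _ (rowMul lam.1 (P₁.lieA (x t).1 u.1))] at hfin
    rw [lagrangianDeriv]
    linarith
  · have hopt := hlam.lagrangian_eq hP₁ hP₂ ht
    rw [lagrangian] at hopt
    simp only [Pi.sub_apply, hp₁t, hp₂t, hlam.1.1, norm_zero]
    linarith
  · filter_upwards [hmem, hnonneg hlam.1.2.1 hqp.nonneg₁, hnonneg hlam.1.2.2 hqp.nonneg₂,
      htend.eventually hR] with s hs h₁ h₂ h₃
    have h := lagrangian_le_sqDist_add (lam := (p₁ s, p₂ s)) hP₁ hP₂ hs h₁ h₂ h₃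
    rw [lagrangian] at h
    simp only [Pi.sub_apply]
    linarith

/-- The quadratic program is infeasible at a state at which the bodies intersect. -/
lemma sqDist_pos_of_qpFeasible_nonempty (hP₁ : P₁.Regular X) (hP₂ : P₂.Regular X)
    (hε₁ : 0 < ε₁) (hε₂ : 0 < ε₂) (hα : IsClassK α)
    {x : EuclideanSpace ℝ (Fin n) × EuclideanSpace ℝ (Fin n)} (hx : x ∈ X ×ˢ X)
    (h : (qpFeasible P₁ P₂ U α ε₁ ε₂ M x).Nonempty) : 0 < sqDist P₁ P₂ x := by
  refine lt_of_le_of_ne sqDist_nonneg fun h0 => ?_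
  obtain ⟨⟨u, d⟩, lam, hlam, hqp⟩ := h
  obtain rfl := hlam.eq_zero hP₁ hP₂ hx h0.symm
  obtain ⟨z₁, hz₁, z₂, hz₂, hz⟩ := exists_sqDist_eq hP₁ hP₂ hx
  obtain rfl : z₁ = z₂ := by
    rw [← h0, eq_comm, sq_eq_zero_iff, norm_eq_zero, sub_eq_zero] at hz
    exact hz
  have hb := hqp.barrier
  have hp := hqp.plane
  simp only [Prod.fst_zero, Prod.snd_zero, rowMul_zero_left, add_zero] at hp
  -- Every component of `lam = 0` lies below `ε₂`, so `d` is nonnegative and can itself be paired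
  -- with the common point.
  have e₁ := inner_rowMul_le (fun k => hqp.nonneg₁ k hε₂) hz₁
  have e₂ := inner_rowMul_le (fun k => hqp.nonneg₂ k hε₂) hz₂
  rw [hp, inner_neg_left] at e₁
  have hneg : α (sqDist P₁ P₂ x - ε₁ ^ 2) < 0 := by
    rw [← hα.map_zero]
    exact hα.strictMono (by rw [← h0]; linarith [sq_pos_of_pos hε₁])
  simp only [lagrangianDeriv, Prod.fst_zero, Prod.snd_zero, rowMul_zero_left, inner_zero_left,
    zero_dotProduct] at hb
  linarith

lemma mem_superlevel {c : ℝ} {x : EuclideanSpace ℝ (Fin n) × EuclideanSpace ℝ (Fin n)}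
    (hx : x ∈ X ×ˢ X) (h : c < sqDist P₁ P₂ x) : x ∈ superlevel P₁ P₂ X c :=
  ⟨hx, subset_closure ⟨hx, h⟩⟩

/-- If the squared distance is positive on the whole safe set, then the safe set is the whole
connected state space. -/
lemma prod_subset_superlevel_zero (hP₁ : P₁.Regular X) (hP₂ : P₂.Regular X)
    (hX : IsPreconnected X) (hpos : ∀ y ∈ superlevel P₁ P₂ X 0, 0 < sqDist P₁ P₂ y)
    (hne : (superlevel P₁ P₂ X 0).Nonempty) : X ×ˢ X ⊆ superlevel P₁ P₂ X 0 := by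
  obtain ⟨V, hV, hVe⟩ := (continuousOn_iff'.1
    (locallyLipschitzOn_sqDist hP₁ hP₂).continuousOn) (Ioi 0) isOpen_Ioi
  have hmemV : ∀ y ∈ X ×ˢ X, 0 < sqDist P₁ P₂ y ↔ y ∈ V := fun y hy =>
    ⟨fun h => (hVe.subset ⟨h, hy⟩).1, fun h => (hVe.superset ⟨h, hy⟩).1⟩
  by_contra hcon
  obtain ⟨z, hz, hzn⟩ := not_subset.1 hcon
  obtain ⟨w, hw⟩ := hne
  -- Otherwise `{h > 0}` and the complement of its closure would be disjoint relatively open sets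
  -- that cover `X × X`, both nonempty there.
  obtain ⟨y, hy, hyV, hyW⟩ := (hX.prod hX) V
    (closure {y | y ∈ X ×ˢ X ∧ 0 < sqDist P₁ P₂ y})ᶜ hV isClosed_closure.isOpen_compl
    (fun y hy => or_iff_not_imp_right.2 fun h =>
      (hmemV y hy).1 (hpos y ⟨hy, not_not.1 h⟩))
    ⟨w, hw.1, (hmemV w hw.1).1 (hpos w hw)⟩ ⟨z, hz, fun h => hzn ⟨hz, h⟩⟩
  exact hyW (subset_closure ⟨hy, (hmemV y hy).2 hyV⟩)

/-- A Filippov solution of the closed loop that starts with squared distance above `ε₁²` keeps it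
above `ε₁²`. -/
lemma lt_sqDist_of_isFilippovSolution (hP₁ : P₁.Regular X) (hP₂ : P₂.Regular X)
    (hUc : Convex ℝ U) (hU : IsCompact U) (hε₂ : 0 < ε₂) (hα : IsClassK α)
    (hα_lip : LocallyLipschitz α)
    {u : EuclideanSpace ℝ (Fin n) × EuclideanSpace ℝ (Fin n) →
      EuclideanSpace ℝ (Fin m) × EuclideanSpace ℝ (Fin m)}
    (hu : ∀ y ∈ superlevel P₁ P₂ X (ε₁ ^ 2),
      ∃ dlam, (u y, dlam) ∈ qpFeasible P₁ P₂ U α ε₁ ε₂ M y)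
    {T : ℝ} {x : ℝ → EuclideanSpace ℝ (Fin n) × EuclideanSpace ℝ (Fin n)}
    (hx : IsFilippovSolution (X ×ˢ X) (closedLoop P₁ P₂ u) T x)
    (h0 : ε₁ ^ 2 < sqDist P₁ P₂ (x 0)) {t : ℝ} (ht : t ∈ Icc 0 T) :
    ε₁ ^ 2 < sqDist P₁ P₂ (x t) := by
  have hlip := locallyLipschitzOn_sqDist hP₁ hP₂
  have hxc : ContinuousOn x (Icc 0 T) := by
    simpa [uIcc_of_le hx.nonneg] using hx.absCont.continuousOn
  have hφc : ContinuousOn (fun s => sqDist P₁ P₂ (x s)) (Icc 0 T) :=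
    hlip.continuousOn.comp hxc hx.mem
  by_contra hcon
  obtain ⟨τ, ⟨hτ, hτle⟩, hτmin⟩ :
      ∃ τ, IsLeast (Icc 0 T ∩ {s | sqDist P₁ P₂ (x s) ≤ ε₁ ^ 2}) τ := by
    refine IsCompact.exists_isLeast ?_ ⟨t, ht, not_lt.1 hcon⟩
    exact isCompact_Icc.of_isClosed_subset
      (hφc.preimage_isClosed_of_isClosed isClosed_Icc isClosed_Iic) inter_subset_left
  have hτle : sqDist P₁ P₂ (x τ) ≤ ε₁ ^ 2 := hτle
  have hbefore : ∀ s ∈ Ico 0 τ, ε₁ ^ 2 < sqDist P₁ P₂ (x s) := fun s hs =>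
    not_le.1 fun h => (hτmin ⟨⟨hs.1, hs.2.le.trans hτ.2⟩, h⟩).not_gt hs.2
  have hτpos : 0 < τ := hτ.1.lt_of_ne fun h => (h ▸ hτle).not_gt h0
  have hsub : Icc 0 τ ⊆ Icc 0 T := Icc_subset_Icc_right hτ.2
  have hleft : 𝓝[<] τ ≤ 𝓝[Icc 0 T] τ := by
    rw [← nhdsWithin_Ico_eq_nhdsLT hτpos]
    exact nhdsWithin_mono _ (Ico_subset_Icc_self.trans hsub)
  -- At the first exit time the argument of `α` is exactly `0`, so a Lipschitz constant of `α` near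
  -- `0` serves on a short interval before `τ`.
  have hτeq : sqDist P₁ P₂ (x τ) = ε₁ ^ 2 := by
    refine hτle.antisymm (ge_of_tendsto ((hφc τ hτ).tendsto.mono_left hleft) ?_)
    filter_upwards [Ico_mem_nhdsLT hτpos] with s hs using (hbefore s hs).le
  obtain ⟨K, W, hW, hKW⟩ := hlip (hx.mem τ hτ)
  obtain ⟨L, V, hV, hLV⟩ := hα_lip 0
  have hxW : ∀ᶠ s in 𝓝[Icc 0 T] τ, x s ∈ W :=
    (tendsto_nhdsWithin_iff.2 ⟨hxc τ hτ, eventually_nhdsWithin_of_forall hx.mem⟩) hW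
  have hφV : ∀ᶠ s in 𝓝[Icc 0 T] τ, sqDist P₁ P₂ (x s) - ε₁ ^ 2 ∈ V := by
    have := (hφc τ hτ).sub_const (ε₁ ^ 2)
    refine this ?_
    change V ∈ 𝓝 (sqDist P₁ P₂ (x τ) - ε₁ ^ 2)
    rwa [show sqDist P₁ P₂ (x τ) - ε₁ ^ 2 = 0 by rw [hτeq, sub_self]]
  obtain ⟨a, haτ, ha⟩ := (mem_nhdsLE_iff_exists_Icc_subset).1 <| by
    have hle : 𝓝[≤] τ ≤ 𝓝[Icc 0 T] τ := by
      rw [← nhdsWithin_Icc_eq_nhdsLE hτpos]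
      exact nhdsWithin_mono _ hsub
    exact hle (hxW.and hφV)
  set t₀ := max a 0 with ht₀
  have ht₀τ : t₀ < τ := max_lt haτ hτpos
  have hgood : ∀ s ∈ Icc t₀ τ, x s ∈ W ∧ sqDist P₁ P₂ (x s) - ε₁ ^ 2 ∈ V := fun s hs =>
    ha ⟨(le_max_left _ _).trans hs.1, hs.2⟩
  have hac : AbsolutelyContinuousOnInterval (fun s => sqDist P₁ P₂ (x s)) t₀ τ := by
    refine absolutelyContinuousOnInterval_comp hKW (hx.absCont.mono ?_) ?_
    · rw [uIcc_of_le ht₀τ.le, uIcc_of_le hx.nonneg]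
      exact Icc_subset_Icc (le_max_right _ _) hτ.2
    · rw [uIcc_of_le ht₀τ.le]
      exact fun s hs => (hgood s hs).1
  have hconst : AbsolutelyContinuousOnInterval (fun _ : ℝ => ε₁ ^ 2) t₀ τ :=
    ContDiffOn.absolutelyContinuousOnInterval contDiffOn_const
  have hgron := exp_mul_le_of_ae_deriv_ge (K := L) ht₀τ.le (hac.fun_sub hconst) ?_
  · rw [hτeq, sub_self, mul_zero] at hgron
    have h1 := hbefore t₀ ⟨le_max_right _ _, ht₀τ⟩
    exact absurd hgron (not_le.2 (mul_pos (Real.exp_pos _) (sub_pos.2 h1)))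
  · filter_upwards [(ae_restrict_iff' measurableSet_Icc).1 hx.deriv_mem] with s hs hsmem η hη
    have hs0 : 0 ≤ s := (le_max_right _ _).trans hsmem.1.le
    have hsT : s < T := hsmem.2.trans_le hτ.2
    obtain ⟨v, hv, hxv⟩ := hs ⟨hs0, hsT.le⟩
    have hsX := hx.mem s ⟨hs0, hsT.le⟩
    have hpos := hbefore s ⟨hs0, hsmem.2⟩
    obtain ⟨lam, hlamf, hlame⟩ := exists_lagrangian_eq_sqDist hP₁ hP₂ hsX
    have hlam := isDualOptimal_of_lagrangian_eq hP₁ hP₂ hsX hlamf hlame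
    -- Before `τ` the inequality is strict, so a whole relative neighbourhood of the state lies in
    -- the set where the feedback is feasible.
    have hnear : ∀ᶠ y in 𝓝[X ×ˢ X] (x s),
        ∃ dlam, (u y, dlam) ∈ qpFeasible P₁ P₂ U α ε₁ ε₂ M y := by
      filter_upwards [(hlip.continuousOn _ hsX).eventually_const_lt hpos, self_mem_nhdsWithin]
        with y hy hyX
      exact hu y (mem_superlevel hyX hy)
    have hvf := filippovMap_subset_feasibleVelocities hP₁ hP₂ hUc hU hα.continuous hsX hlam hnear hv
    have hη' : HasDerivAt (fun s => sqDist P₁ P₂ (x s)) η s := by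
      simpa using hη.add_const (ε₁ ^ 2)
    have hge := neg_le_of_hasDerivAt_sqDist hP₁ hP₂ hε₂ hsX
      (by filter_upwards [Ioo_mem_nhdsGT hsT] with w hw
          exact hx.mem w ⟨hs0.trans hw.1.le, hw.2.le⟩) hlam hxv hvf hη'
    have hαle := hLV.dist_le_mul _ (hgood s (Ioo_subset_Icc_self hsmem)).2 _ (mem_of_mem_nhds hV)
    rw [hα.map_zero, dist_zero_right, dist_zero_right, Real.norm_eq_abs,
      Real.norm_of_nonneg (sub_pos.2 hpos).le] at hαle
    have := le_abs_self (α (sqDist P₁ P₂ (x s) - ε₁ ^ 2))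
    linarith

end Pair

end PolytopeNCBF

end

theorem theorem1 {n m l r₁ r₂ : ℕ}
    (X : Set (EuclideanSpace ℝ (Fin n))) (hX : IsConnected X)
    (U : Set (EuclideanSpace ℝ (Fin m))) (hU_convex : Convex ℝ U) (hU_compact : IsCompact U)
    (P₁ : PolytopeNCBF.Robot n m l r₁) (P₂ : PolytopeNCBF.Robot n m l r₂)
    (hP₁ : P₁.Regular X) (hP₂ : P₂.Regular X)
    (ε₁ ε₂ M : ℝ) (hε₁ : 0 < ε₁) (hε₂ : 0 < ε₂)
    (α : ℝ → ℝ) (hα : PolytopeNCBF.IsClassK α) (hα_lip : LocallyLipschitz α)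
    (J : EuclideanSpace ℝ (Fin n) × EuclideanSpace ℝ (Fin n) →
      (EuclideanSpace ℝ (Fin m) × EuclideanSpace ℝ (Fin m)) ×
        ((Fin r₁ → ℝ) × (Fin r₂ → ℝ)) → ℝ)
    (u : EuclideanSpace ℝ (Fin n) × EuclideanSpace ℝ (Fin n) →
      EuclideanSpace ℝ (Fin m) × EuclideanSpace ℝ (Fin m))
    (T : ℝ) (x : ℝ → EuclideanSpace ℝ (Fin n) × EuclideanSpace ℝ (Fin n))
    (hx : PolytopeNCBF.IsFilippovSolution (X ×ˢ X) (PolytopeNCBF.closedLoop P₁ P₂ u) T x) :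
    -- feasibility on the whole safe set `S = cl {h > 0}`
    ((∀ y ∈ PolytopeNCBF.superlevel P₁ P₂ X 0,
        (PolytopeNCBF.qpFeasible P₁ P₂ U α ε₁ ε₂ M y).Nonempty) →
      PolytopeNCBF.IsQPFeedback P₁ P₂ X U α ε₁ ε₂ M J (PolytopeNCBF.superlevel P₁ P₂ X 0) u →
      x 0 ∈ PolytopeNCBF.superlevel P₁ P₂ X 0 →
      ∀ t ∈ Icc 0 T, x t ∈ PolytopeNCBF.superlevel P₁ P₂ X 0) ∧
    -- feasibility on the tightened safe set `cl {h > ε₁²}` only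
    ((∀ y ∈ PolytopeNCBF.superlevel P₁ P₂ X (ε₁ ^ 2),
        (PolytopeNCBF.qpFeasible P₁ P₂ U α ε₁ ε₂ M y).Nonempty) →
      PolytopeNCBF.IsQPFeedback P₁ P₂ X U α ε₁ ε₂ M J
        (PolytopeNCBF.superlevel P₁ P₂ X (ε₁ ^ 2)) u →
      ε₁ ^ 2 < PolytopeNCBF.sqDist P₁ P₂ (x 0) →
      ∀ t ∈ Icc 0 T, ε₁ ^ 2 < PolytopeNCBF.sqDist P₁ P₂ (x t) ∧
        x t ∈ PolytopeNCBF.superlevel P₁ P₂ X 0) := by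
  refine ⟨fun hfeas _ h0 t ht => ?_, fun _ hu h0 t ht => ?_⟩
  · exact PolytopeNCBF.prod_subset_superlevel_zero hP₁ hP₂ hX.isPreconnected
      (fun y hy => PolytopeNCBF.sqDist_pos_of_qpFeasible_nonempty hP₁ hP₂ hε₁ hε₂ hα hy.1
        (hfeas y hy)) ⟨x 0, h0⟩ (hx.mem t ht)
  · have h := PolytopeNCBF.lt_sqDist_of_isFilippovSolution hP₁ hP₂ hU_convex hU_compact hε₂ hα
      hα_lip (fun y hy => (hu.isMin y hy).imp fun _ h => h.1) hx h0 ht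
    exact ⟨h, PolytopeNCBF.mem_superlevel (hx.mem t ht) ((sq_nonneg ε₁).trans_lt h)⟩
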